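/- Let $(I,\mathcal T)$ be a locally finite tree with root $r$ in which every branch $[i,\infty)=\{j: i\preceq j\}$ is infinite, where $i\preceq j$ means that $i$ lies on the geodesic from $r$ to $j$; let $|i|$ be the distance from $r$ to $i$. Let $w:\mathbb N\to(0,\infty)$ be strictly increasing, $w_{-1}=0$, $\Delta_k(w)=w_k-w_{k-1}$, and let $U_{ij}=w_{|i\wedge j|}$ be the associated tree matrix, where $i\wedge j$ is the last common vertex of the geodesics from $r$ to $i$ and to $j$. Let $\partial_\infty$ be the boundary of the tree; write $\xi\in\partial_\infty$ as the geodesic $(\xi(0)=r,\xi(1),\xi(2),\dots)$, put $C^k(\xi)=\{\eta\in\partial_\infty:\eta(k)=\xi(k)\}$, and equip $\partial_\infty$ with the $\sigma$-field generated by these sets. Extend $U$ to $\partial_\infty$ by $U_{\xi\eta}=w_{|\xi\wedge\eta|}$ for $\xi\ne\eta$ and $U_{\xi\xi}=\lim_n w_n\in(0,\infty]$. Add an absorbing state $\partial_r\notin I$. Let $X$ be the minimal continuous time Markov chain on $I\cup\{\partial_r\}$, started at $r$, that jumps between neighbours $i,j\in I$ with $|j|=|i|+1$ at rate $\Delta_{|j|}(w)^{-1}$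 in both directions and from $r$ to $\partial_r$ at rate $w_0^{-1}$ (its generator restricted to $I$ is the $q$-matrix $Q$ with $-QU=\mathbb I$). Let $\zeta$ be the minimum of the hitting time $T_{\partial_r}$ of $\partial_r$ and the explosion time, and $X_\zeta$ the limit of $X_t$ as $t\uparrow\zeta$ when $T_{\partial_r}=\infty$. Assume transience, $\mathbb P_r\{T_{\partial_r}<\infty\}<1$, and let $\mu=\mathbb P_r\{X_\zeta\in\cdot\mid X_\zeta\in\partial_\infty\}$ be the exit measure. Then $\mu$ is a probability measure on $\partial_\infty$ and the following holds. 1. For every $f\in L^2(\mu)$ one has $\int U_{\eta\xi}|f(\xi)|\,\mu(d\xi)<\infty$ for $\mu$-a.e. $\eta$, and $Wf(\eta)=\int_{\partial_\infty}U_{\eta\xi}f(\xi)\,\mu(d\xi)$ defines a bounded self-adjoint operator $W$ on $L^2(\mu)$. 2. $W$ is a stochastic integral operator: let $\mathcal F_n$ be the $\sigma$-field generated by the sets $C^n(\xi)$, $\xi\in\partial_\infty$, and $\mathbb E_\mu(\cdot\mid\mathcal F_{-1})=0$. There is an $(\mathcal F_n)$-predictable real process $G=(G_n)_{n\ge0}$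 (that is, $G_0$ is $\mathcal F_0$-measurable and $G_{n+1}$ is $\mathcal F_n$-measurable for all $n\ge 0$) such that $$Wf=\sum_{n\ge 0}G_n\big(\mathbb E_\mu(f\mid\mathcal F_n)-\mathbb E_\mu(f\mid\mathcal F_{n-1})\big)\qquad\text{for all } f\in L^2(\mu),$$ the terms being in $L^2(\mu)$ and the series converging unconditionally in $L^2(\mu)$. Moreover, for $\mu$-a.e. $\eta$, the sequence $(G_n(\eta))_n$ is positive and decreasing to $0$, and $G_n(\eta)=\sum_{k\ge n}\Delta_k(w)\,\mu(C^k(\eta))$ for all $n$. -/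

import Mathlib

open MeasureTheory ProbabilityTheory Filter Topology
open scoped ENNReal NNReal

namespace TreeBoundary

noncomputable section

/-! ### Rooted trees and their boundary -/

/-- `i ≼ j`: the vertex `i` lies on the geodesic joining the root `r` to `j`. -/
def Prec {I : Type*} (T : SimpleGraph I) (r i j : I) : Prop :=
  ∃ p : T.Walk r j, p.IsPath ∧ i ∈ p.support

/-- The level `|i|` of a vertex. -/
def level {I : Type*} (T : SimpleGraph I) (r i : I) : ℕ := T.dist r i

/-- The successors `S_i` of a vertex. -/
def successors {I : Type*} (T : SimpleGraph I) (r i : I) : Set I :=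
  {j | T.Adj i j ∧ Prec T r i j}

/-- The boundary of the tree: a boundary point `ξ` is represented by its geodesic
`(ξ(0) = r, ξ(1), ξ(2), …)`, the unique infinite chain with origin `r` in its class. -/
def Ends {I : Type*} (T : SimpleGraph I) (r : I) : Type _ :=
  {ξ : ℕ → I // ξ 0 = r ∧ (∀ n, T.Adj (ξ n) (ξ (n + 1))) ∧ Function.Injective ξ}

instance {I : Type*} (T : SimpleGraph I) (r : I) : CoeFun (Ends T r) (fun _ => ℕ → I) :=
  ⟨Subtype.val⟩

/-- The set of boundary points `η` with `i ≼ η`, that is, with `i` on the geodesic of `η`. -/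
def cylinder {I : Type*} (T : SimpleGraph I) (r i : I) : Set (Ends T r) :=
  {η | ∃ n, η n = i}

/-- The Borel `σ`-field of the boundary, generated by the sets `{η | i ≼ η}`. -/
instance {I : Type*} (T : SimpleGraph I) (r : I) : MeasurableSpace (Ends T r) :=
  MeasurableSpace.generateFrom (Set.range (cylinder T r))

/-- The set `C^k(ξ)` of boundary points `η` with `η(k) = ξ(k)`. -/
def levelSet {I : Type*} {T : SimpleGraph I} {r : I} (k : ℕ) (ξ : Ends T r) : Set (Ends T r) :=
  cylinder T r (ξ k)

/-- The level `|ξ ∧ η|` of the last common vertex of the geodesics of `ξ ≠ η`. -/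
def meetLevel {I : Type*} {T : SimpleGraph I} {r : I} (ξ η : Ends T r) : ℕ :=
  sSup {n | ξ n = η n}

/-- The level filtration: `F_n` is generated by the sets `C^k(ξ)` with `k ≤ n`. In a locally
finite tree `C^k(ξ)` is a finite union of sets `C^n(ξ')`, so that `F_n` is generated
by the sets `C^n(ξ')` alone. -/
def levelFiltration {I : Type*} (T : SimpleGraph I) (r : I) :
    Filtration ℕ (inferInstance : MeasurableSpace (Ends T r)) where
  seq n := MeasurableSpace.generateFrom {A | ∃ k ≤ n, ∃ ξ : Ends T r, A = levelSet k ξ}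
  mono' := by
    intro m n hmn
    refine MeasurableSpace.generateFrom_mono ?_
    rintro A ⟨k, hk, ξ, rfl⟩
    exact ⟨k, hk.trans hmn, ξ, rfl⟩
  le' := by
    intro n
    refine MeasurableSpace.generateFrom_le ?_
    rintro A ⟨k, -, ξ, rfl⟩
    exact MeasurableSpace.measurableSet_generateFrom ⟨ξ k, rfl⟩

/-! ### The tree matrix and its generator -/

/-- `Δ_k(w) = w_k - w_{k-1}`, with the convention `w_{-1} = 0`. -/
def increment (w : ℕ → ℝ) : ℕ → ℝ
  | 0 => w 0
  | k + 1 => w (k + 1) - w k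

/-- The extension of the tree matrix to the boundary: `U_{ξη} = w_{|ξ ∧ η|}` if `ξ ≠ η`, and
`U_{ξξ} = lim w_n` (the supremum of the increasing sequence `w`), which may be infinite. -/
def boundaryKernel {I : Type*} {T : SimpleGraph I} {r : I} (w : ℕ → ℝ) (ξ η : Ends T r) : ℝ≥0∞ :=
  open Classical in
  if ξ = η then ⨆ n, ENNReal.ofReal (w n) else ENNReal.ofReal (w (meetLevel ξ η))

/-- The conservative `q`-matrix on `I ∪ {∂_r}` associated with the tree matrix; the
absorbing state `∂_r` is `none`. -/
def generator {I : Type*} (T : SimpleGraph I) (r : I) (w : ℕ → ℝ) : Option I → Option I → ℝ :=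
  open Classical in
  fun a b => match a, b with
  | some i, some j =>
      if i = j then
        -((increment w (level T r i))⁻¹
          + ((successors T r i).ncard : ℝ) * (increment w (level T r i + 1))⁻¹)
      else if T.Adj i j then (increment w (max (level T r i) (level T r j)))⁻¹
      else 0
  | some i, none => if i = r then (w 0)⁻¹ else 0
  | none, _ => 0

/-! ### Minimal continuous time Markov chains, through jump chain and holding times -/

/-- Transition probabilities of the discrete skeleton of a conservative `q`-matrix. -/
def jumpProb {S : Type*} (q : S → S → ℝ) (a b : S) : ℝ :=
  open Classical in
  if q a a = 0 then (if a = b then 1 else 0)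
  else (if a = b then 0 else q a b / (-q a a))

/-- `Y` is the sequence of visited states and `E` the sequence of holding times of a minimal
continuous time Markov chain with `q`-matrix `q` started at `x`: `Y` is a Markov chain from `x`
with the jump probabilities of `q` and, given `Y`, the `E n` are independent, exponential with
parameters `-q (Y n) (Y n)` (so that `E n = ∞` at absorbing states). -/
structure IsMinimalChain {S Ω : Type*} [MeasurableSpace Ω] (q : S → S → ℝ) (x : S)
    (P : Measure Ω) (Y : ℕ → Ω → S) (E : ℕ → Ω → ℝ≥0∞) : Prop where
  measurableSet_state : ∀ n a, MeasurableSet {ω | Y n ω = a}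
  measurable_time : ∀ n, Measurable (E n)
  law : ∀ (n : ℕ) (s : ℕ → S) (t : ℕ → ℝ≥0), s 0 = x →
    P {ω | ∀ k ≤ n, Y k ω = s k ∧ (t k : ℝ≥0∞) < E k ω} =
      ENNReal.ofReal ((∏ k ∈ Finset.range n, jumpProb q (s k) (s (k + 1))) *
        ∏ k ∈ Finset.range (n + 1), Real.exp (q (s k) (s k) * (t k : ℝ)))
  start : ∀ᵐ ω ∂P, Y 0 ω = x

/-- The time of the `n`-th jump. -/
def jumpTime {Ω : Type*} (E : ℕ → Ω → ℝ≥0∞) (n : ℕ) (ω : Ω) : ℝ≥0∞ :=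
  ∑ k ∈ Finset.range n, E k ω

/-- The explosion time of the chain. -/
def explosionTime {Ω : Type*} (E : ℕ → Ω → ℝ≥0∞) (ω : Ω) : ℝ≥0∞ := ∑' k, E k ω

/-- `X_t = a`, where `X_t = Y_n` for `t` between the `n`-th and the `(n+1)`-st jump. -/
def InState {S Ω : Type*} (Y : ℕ → Ω → S) (E : ℕ → Ω → ℝ≥0∞) (t : ℝ≥0∞) (a : S) (ω : Ω) : Prop :=
  ∃ n, jumpTime E n ω ≤ t ∧ t < jumpTime E (n + 1) ω ∧ Y n ω = a

/-- The hitting time `T_a = inf {t | X_t = a}`. -/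
def hittingTime {S Ω : Type*} (Y : ℕ → Ω → S) (E : ℕ → Ω → ℝ≥0∞) (a : S) (ω : Ω) : ℝ≥0∞ :=
  sInf {t | InState Y E t a ω}

/-- `X_ζ = ξ ∈ ∂_∞`, where `ζ` is the lifetime: the chain never reaches `∂_r`, and as `t`
increases to `ζ` (then the explosion time, possibly infinite) `X_t` converges to `ξ`: it is
eventually in the branch `[ξ(m), ∞)`, for every `m`. -/
def ExitsAt {I Ω : Type*} {T : SimpleGraph I} {r : I} (Y : ℕ → Ω → Option I)
    (E : ℕ → Ω → ℝ≥0∞) (ω : Ω) (ξ : Ends T r) : Prop :=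
  hittingTime Y E none ω = ∞ ∧
    ∀ m, ∀ᶠ t in 𝓝[<] (explosionTime E ω), ∃ j, InState Y E t (some j) ω ∧ Prec T r (ξ m) j

/-- The exit measure `μ = P(X_ζ ∈ · | X_ζ ∈ ∂_∞)`: the law of `X_ζ` under the conditional
probability. (An infinite, locally finite tree has a nonempty boundary; the second case is void.) -/
def exitMeasure {I Ω : Type*} [MeasurableSpace Ω] (T : SimpleGraph I) (r : I) (P : Measure Ω)
    (Y : ℕ → Ω → Option I) (E : ℕ → Ω → ℝ≥0∞) : Measure (Ends T r) :=
  open Classical in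
  if _h : Nonempty (Ends T r) then
    (ProbabilityTheory.cond P {ω | ∃ ξ : Ends T r, ExitsAt Y E ω ξ}).map
      (fun ω => Classical.epsilon (fun ξ : Ends T r => ExitsAt Y E ω ξ))
  else 0

/-- `W f(η) = ∫ U_{ηξ} f(ξ) μ(dξ)`. -/
def boundaryOperator {I : Type*} {T : SimpleGraph I} {r : I} (w : ℕ → ℝ) (μ : Measure (Ends T r))
    (f : Ends T r → ℝ) (η : Ends T r) : ℝ :=
  ∫ ξ, (boundaryKernel w η ξ).toReal * f ξ ∂μ

/-! ### Stochastic integral operators -/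

/-- `E_μ(f | F_n) - E_μ(f | F_{n-1})`, with the convention `E_μ(f | F_{-1}) = 0`. -/
def condExpIncrement {X : Type*} {m : MeasurableSpace X} (μ : Measure X) (F : Filtration ℕ m)
    (f : X → ℝ) : ℕ → X → ℝ
  | 0 => μ[f | F 0]
  | n + 1 => μ[f | F (n + 1)] - μ[f | F n]

/-- `W = ∑ₙ Gₙ (E_μ(· | Fₙ) - E_μ(· | Fₙ₋₁))` on `L²(μ)` with an `F`-predictable process `G`, the
series applied to any `f` being convergent in `L²(μ)`. -/
structure IsStochasticIntegral {X : Type*} {m : MeasurableSpace X} (μ : Measure X)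
    (F : Filtration ℕ m) (G : ℕ → X → ℝ) (W : Lp ℝ 2 μ →L[ℝ] Lp ℝ 2 μ) : Prop where
  predictable : IsStronglyPredictable F G
  hasSum : ∀ f : Lp ℝ 2 μ,
    ∃ h : ∀ n, MemLp (fun x => G n x * condExpIncrement μ F f n x) 2 μ,
      HasSum (fun n => (h n).toLp) (W f)

end

end TreeBoundary

open TreeBoundary

/-! The core is that the exit measure has constant potential: for `μ`-a.e. η the sum ∑_k Δ_k(w)
μ(C^k(η)) equals M = w_0 / c, where c is the probability of never reaching ∂_r.

Let p_n(v) be the probability that the jump chain is in the branch of v after n jumps. The chain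
enters or leaves this branch only through the edge joining v to its parent, and both rates along
that edge are 1/Δ_{|v|}(w). Hence Δ_{|v|}(w) (p_{n+1}(v) - p_n(v)) is the difference of P(Y_n =
·)/rate between the parent and v. Along a geodesic these differences telescope, and summing over
time gives `potential_end`: the potential of p_n truncated at level K, plus a partial Green function
at ξ(K), equals w_0. The Green function being bounded, every vertex is visited finitely often, a
surviving path converges to an end, and p_n(v) tends to c times the exit probability of the cylinder
of v. Dropping the Green term and letting n → ∞ bounds the potential of `μ` by M everywhere. For K =
n the Green term vanishes, so the truncated potential of p_n is w_0 on every end. The mutual energy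
of p_n and `μ` up to level n is therefore w_0, while the energy of p_n is at most w_0 p_n(r).
Cauchy-Schwarz and n → ∞ show that the potential of `μ` has `μ`-mean at least M, so it equals M
almost everywhere (`exitMeasure_equilibrium`).

Constancy makes the tail ∑_{k ≥ n} Δ_k(w) μ(C^k) equal a.e. to G_n = M - ∑_{k < n} Δ_k(w) μ(C^k),
which involves only levels below n: it is predictable with values in [0, M]. The martingale
transform by G has orthogonal terms dominated by the increments of f, so it converges
unconditionally, and it is symmetric on all of L², hence bounded (`exists_transform`). Finally
U_{ηξ} = ∑_k Δ_k(w) 1[ξ ∈ C^k(η)], so Wf = ∑_k Δ_k(w) μ(C^k) E(f | F_k); summation by parts turns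
this into the transform, since G_n → 0 a.e. and E(f | F_n) converges a.e.
(`ae_eq_boundaryOperator`). -/

namespace TreeBoundary

/-! ### Combinatorics of rooted trees -/

section Combinatorics

variable {I : Type*} {T : SimpleGraph I} {r : I}

/-- `v` is a child of `u`. -/
def IsChild (T : SimpleGraph I) (r u v : I) : Prop := T.Adj u v ∧ level T r v = level T r u + 1

theorem level_root : level T r r = 0 := SimpleGraph.dist_self

theorem level_eq_zero (hT : T.IsTree) {i : I} : level T r i = 0 ↔ i = r :=
  hT.connected.dist_eq_zero_iff.trans eq_comm

theorem IsChild.of_adj (hT : T.IsTree) {i j : I} (h : T.Adj i j) :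
    IsChild T r i j ∨ IsChild T r j i := by
  rcases hT.dist_eq_dist_add_one_of_adj r h with h' | h'
  · exact .inr ⟨h.symm, h'⟩
  · exact .inl ⟨h, h'⟩

theorem length_eq_level (hT : T.IsTree) {v : I} {p : T.Walk r v} (hp : p.IsPath) :
    p.length = level T r v := by
  obtain ⟨q, hq, hl⟩ := hT.connected.exists_path_of_dist r v
  rw [(hT.existsUnique_path r v).unique hp hq, hl]; rfl

/-- The path from r to v is the path from r to u followed by the edge uv. This recursion for `Prec`
drives the inductions along the tree. -/
theorem IsChild.prec_iff (hT : T.IsTree) {u v : I} (h : IsChild T r u v) (i : I) :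
    Prec T r i v ↔ i = v ∨ Prec T r i u := by
  obtain ⟨p, hp, -⟩ := hT.connected.exists_path_of_dist r u
  obtain ⟨q, hq, -⟩ := hT.connected.exists_path_of_dist r v
  have hv : v ∉ p.support := by
    intro hv
    -- If v were on the path to u, that path would be the path to v followed by the edge vu, of
    -- length |u| + 2.
    have h1 := hT.isAcyclic.path_concat hq hp h.1.symm hv
    have h2 := congrArg SimpleGraph.Walk.length h1
    rw [SimpleGraph.Walk.length_concat, length_eq_level hT hp, length_eq_level hT hq, h.2] at h2
    omega
  have hpc := hp.concat hv h.1
  constructor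
  · rintro ⟨p', hp', hi⟩
    rw [(hT.existsUnique_path r v).unique hp' hpc, SimpleGraph.Walk.support_concat] at hi
    have hi' : i ∈ p.support ∨ i = v := by simpa using hi
    exact hi'.symm.imp_right fun hi => ⟨p, hp, hi⟩
  · rintro (rfl | ⟨p', hp', hi⟩)
    · exact ⟨_, hpc, SimpleGraph.Walk.end_mem_support _⟩
    · rw [(hT.existsUnique_path r u).unique hp' hp] at hi
      refine ⟨_, hpc, ?_⟩
      rw [SimpleGraph.Walk.support_concat]
      simp [hi]

theorem exists_parent (hT : T.IsTree) {v : I} (hv : v ≠ r) : ∃ u, IsChild T r u v := by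
  obtain ⟨p, hp, hl⟩ := hT.connected.exists_path_of_dist r v
  have hn : ¬ p.Nil := SimpleGraph.Walk.not_nil_of_ne (Ne.symm hv)
  have hadj := p.adj_penultimate hn
  refine ⟨p.penultimate, ((IsChild.of_adj hT hadj).resolve_right fun h => ?_)⟩
  have h1 : level T r p.penultimate ≤ p.dropLast.length := SimpleGraph.dist_le _
  have h2 : p.dropLast.length ≤ p.length := by
    simp [SimpleGraph.Walk.dropLast, SimpleGraph.Walk.take_length]
  have h3 := h.2
  have h4 := length_eq_level hT hp
  omega

theorem tree_induction (hT : T.IsTree) {motive : I → Prop} (root : motive r)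
    (child : ∀ u v, IsChild T r u v → motive u → motive v) (v : I) : motive v := by
  induction h : level T r v generalizing v with
  | zero => rwa [(level_eq_zero hT).1 h]
  | succ n ih =>
    have hv : v ≠ r := by rintro rfl; simp [level_root] at h
    obtain ⟨u, hu⟩ := exists_parent hT hv
    exact child u v hu (ih u (by have := hu.2; omega))

theorem prec_root_right {i : I} (hT : T.IsTree) : Prec T r i r ↔ i = r := by
  constructor
  · rintro ⟨p, hp, hi⟩
    rw [(hT.existsUnique_path r r).unique hp SimpleGraph.Walk.IsPath.nil] at hi
    simpa using hi
  · rintro rfl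
    exact ⟨.nil, .nil, by simp⟩

theorem prec_refl (hT : T.IsTree) (i : I) : Prec T r i i := by
  obtain ⟨p, hp, -⟩ := hT.connected.exists_path_of_dist r i
  exact ⟨p, hp, p.end_mem_support⟩

theorem root_prec (hT : T.IsTree) (i : I) : Prec T r r i := by
  obtain ⟨p, hp, -⟩ := hT.connected.exists_path_of_dist r i
  exact ⟨p, hp, p.start_mem_support⟩

theorem Prec.level_le (hT : T.IsTree) {i j : I} (h : Prec T r i j) :
    level T r i ≤ level T r j ∧ (level T r i = level T r j → i = j) := by
  revert h
  refine tree_induction (r := r) hT (motive := fun j => Prec T r i j →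
    level T r i ≤ level T r j ∧ (level T r i = level T r j → i = j)) ?_ ?_ j
  · intro h; rw [prec_root_right hT] at h; subst h; simp
  · intro u v huv ih h
    rcases (huv.prec_iff hT i).1 h with rfl | h
    · simp
    · have h1 := (ih h).1; have h2 := huv.2
      exact ⟨by omega, fun _ => by omega⟩

theorem Prec.eq_of_level_eq (hT : T.IsTree) {i i' j : I} (h : Prec T r i j) (h' : Prec T r i' j)
    (hl : level T r i = level T r i') : i = i' := by
  revert h h'
  refine tree_induction (r := r) hT (motive := fun j => Prec T r i j → Prec T r i' j → i = i')
    ?_ ?_ j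
  · intro h h'; rw [prec_root_right hT] at h h'; rw [h, h']
  · intro u v huv ih h h'
    rcases (huv.prec_iff hT i).1 h with rfl | h1
    · exact ((h'.level_le hT).2 hl.symm).symm
    · rcases (huv.prec_iff hT i').1 h' with rfl | h2
      · exact (h.level_le hT).2 hl
      · exact ih h1 h2

theorem IsChild.prec (hT : T.IsTree) {u v : I} (h : IsChild T r u v) : Prec T r u v :=
  (h.prec_iff hT u).2 (.inr (prec_refl hT u))

theorem IsChild.unique (hT : T.IsTree) {u u' v : I} (h : IsChild T r u v) (h' : IsChild T r u' v) :
    u = u' :=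
  (h.prec hT).eq_of_level_eq hT (h'.prec hT) (by have := h.2; have := h'.2; omega)

/-- A branch is attached to the rest of the tree by one edge, from its top vertex to the parent. The
flux identities and the convergence of paths rest on this. -/
theorem Prec.eq_of_adj_of_not (hT : T.IsTree) {v x y : I} (hxy : T.Adj x y) (hx : Prec T r v x)
    (hy : ¬ Prec T r v y) : v = x ∧ IsChild T r y x := by
  rcases IsChild.of_adj (r := r) hT hxy with h | h
  · exact absurd ((h.prec_iff hT v).2 (.inr hx)) hy
  · exact ⟨((h.prec_iff hT v).1 hx).resolve_right hy, h⟩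

theorem IsChild.not_prec (hT : T.IsTree) {u v : I} (h : IsChild T r u v) : ¬ Prec T r v u :=
  fun h' => by have := (h'.level_le hT).1; have := h.2; omega

theorem mem_successors_iff (hT : T.IsTree) {i j : I} : j ∈ successors T r i ↔ IsChild T r i j := by
  constructor
  · rintro ⟨h, h'⟩
    exact (IsChild.of_adj hT h).resolve_right fun h2 => h2.not_prec hT h'
  · exact fun h => ⟨h.1, h.prec hT⟩

theorem exists_child (hT : T.IsTree) (hbranch : ∀ i, {j | Prec T r i j}.Infinite) (i : I) :
    ∃ j, IsChild T r i j := by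
  by_contra! hc
  refine hbranch i ((Set.finite_singleton i).subset ?_)
  intro j hj
  change j = i
  revert hj
  refine tree_induction (r := r) hT (motive := fun j => Prec T r i j → j = i) ?_ ?_ j
  · intro h; exact ((prec_root_right hT).1 h).symm
  · intro u v huv ih h
    rcases (huv.prec_iff hT i).1 h with h | h
    · exact h.symm
    · exact absurd (ih h ▸ huv) (hc v)

/-- A sequence of successive children from the root is an end. -/
def Ends.ofChild (s : ℕ → I) (h0 : s 0 = r) (hs : ∀ n, IsChild T r (s n) (s (n + 1))) :
    Ends T r :=
  ⟨s, h0, fun n => (hs n).1, by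
    have hl : ∀ n, level T r (s n) = n := by
      intro n
      induction n with
      | zero => rw [h0, level_root]
      | succ n ih => rw [(hs n).2, ih]
    intro m n hmn
    rw [← hl m, ← hl n, hmn]⟩

theorem Ends.isChild (hT : T.IsTree) (ξ : Ends T r) (n : ℕ) : IsChild T r (ξ n) (ξ (n + 1)) := by
  induction n with
  | zero =>
    refine (IsChild.of_adj hT (ξ.2.2.1 0)).resolve_right fun h => ?_
    have := h.2
    rw [ξ.2.1, level_root] at this
    omega
  | succ n ih =>
    refine (IsChild.of_adj hT (ξ.2.2.1 (n + 1))).resolve_right fun h => ?_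
    have := ξ.2.2.2 (ih.unique hT h)
    omega

theorem Ends.level_eq (hT : T.IsTree) (ξ : Ends T r) (n : ℕ) : level T r (ξ n) = n := by
  induction n with
  | zero => rw [ξ.2.1, level_root]
  | succ n ih => rw [(ξ.isChild hT n).2, ih]

theorem Ends.prec_iff (hT : T.IsTree) (ξ : Ends T r) (v : I) (n : ℕ) :
    Prec T r v (ξ n) ↔ ∃ k ≤ n, v = ξ k := by
  induction n with
  | zero => rw [ξ.2.1, prec_root_right hT]; simp [ξ.2.1]
  | succ n ih =>
    rw [(ξ.isChild hT n).prec_iff hT, ih]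
    constructor
    · rintro (h | ⟨k, hk, h⟩)
      · exact ⟨n + 1, le_rfl, h⟩
      · exact ⟨k, by omega, h⟩
    · rintro ⟨k, hk, h⟩
      rcases Nat.lt_or_ge n k with h' | h'
      · obtain rfl : k = n + 1 := by omega
        exact .inl h
      · exact .inr ⟨k, h', h⟩

theorem Ends.exists_apply_eq (hT : T.IsTree) (hbranch : ∀ i, {j | Prec T r i j}.Infinite) (v : I) :
    ∃ ξ : Ends T r, ξ (level T r v) = v := by
  choose c hc using exists_child hT hbranch
  suffices H : ∃ s : ℕ → I, s 0 = r ∧ s (level T r v) = v ∧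
      ∀ n, IsChild T r (s n) (s (n + 1)) by
    obtain ⟨s, h0, hv, hs⟩ := H
    exact ⟨.ofChild s h0 hs, hv⟩
  refine tree_induction (r := r) hT (motive := fun v => ∃ s : ℕ → I, s 0 = r ∧
    s (level T r v) = v ∧ ∀ n, IsChild T r (s n) (s (n + 1))) ?_ ?_ v
  · refine ⟨fun n => c^[n] r, rfl, by simp [level_root], fun n => ?_⟩
    simp only [Function.iterate_succ_apply']
    exact hc _
  · rintro u v huv ⟨s, h0, hu, hs⟩
    -- The end through u is kept up to index |u|; from index |v| = |u| + 1 on, chosen children of v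
    -- are followed.
    refine ⟨fun n => if n ≤ level T r u then s n else c^[n - level T r v] v, by simp [h0], ?_, ?_⟩
    · simp [huv.2]
    · intro n
      rcases lt_trichotomy n (level T r u) with h | h | h
      · simp only [h.le, if_true, Nat.succ_le_of_lt h]; exact hs n
      · subst h; simp only [le_refl, if_true, hu, huv.2]; simpa using huv
      · have h1 : ¬ n ≤ level T r u := by omega
        have h2 : ¬ n + 1 ≤ level T r u := by omega
        have h3 : n + 1 - level T r v = (n - level T r v) + 1 := by have := huv.2; omega
        simp only [h1, h2, if_false, h3, Function.iterate_succ_apply']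
        exact hc _

theorem finite_level_le (hT : T.IsTree) (hfin : ∀ i, (T.neighborSet i).Finite) (n : ℕ) :
    {i | level T r i ≤ n}.Finite := by
  induction n with
  | zero =>
    refine (Set.finite_singleton r).subset fun i hi => ?_
    exact (level_eq_zero hT).1 (Nat.le_zero.1 hi)
  | succ n ih =>
    refine (ih.union (ih.biUnion fun i _ => hfin i)).subset fun i hi => ?_
    by_cases hr : i = r
    · left; subst hr; simp [level_root]
    · obtain ⟨u, hu⟩ := exists_parent hT hr
      right
      have hi' : level T r i ≤ n + 1 := hi
      simp only [Set.mem_iUnion]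
      exact ⟨u, by have := hu.2; change level T r u ≤ n; omega, hu.1⟩

theorem countable_of_finite_neighborSet (hT : T.IsTree) (hfin : ∀ i, (T.neighborSet i).Finite)
    (r : I) : Countable I := by
  rw [← Set.countable_univ_iff]
  refine (Set.countable_iUnion fun n => (finite_level_le (r := r) hT hfin n).countable).mono
    fun i _ => Set.mem_iUnion.2 ⟨level T r i, Set.mem_ofPred.2 le_rfl⟩

/-! ### Cylinders and the level filtration -/

theorem mem_cylinder_iff (hT : T.IsTree) {v : I} {η : Ends T r} :
    η ∈ cylinder T r v ↔ η (level T r v) = v := by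
  constructor
  · rintro ⟨n, rfl⟩; rw [η.level_eq hT]
  · exact fun h => ⟨_, h⟩

theorem mem_levelSet_iff (hT : T.IsTree) {k : ℕ} {ξ η : Ends T r} :
    η ∈ levelSet k ξ ↔ η k = ξ k := by
  rw [levelSet, mem_cylinder_iff hT, ξ.level_eq hT]

theorem measurableSet_cylinder (v : I) : MeasurableSet (cylinder T r v) :=
  MeasurableSpace.measurableSet_generateFrom ⟨v, rfl⟩

theorem Ends.apply_eq_of_le (hT : T.IsTree) {ξ η : Ends T r} {k n : ℕ} (hkn : k ≤ n)
    (h : ξ n = η n) : ξ k = η k := by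
  have h1 : Prec T r (ξ k) (ξ n) := (ξ.prec_iff hT _ _).2 ⟨k, hkn, rfl⟩
  rw [h] at h1
  exact h1.eq_of_level_eq hT ((η.prec_iff hT _ _).2 ⟨k, hkn, rfl⟩)
    (by rw [ξ.level_eq hT, η.level_eq hT])

end Combinatorics

/-! ### Marginals of a minimal chain -/

section Chain

variable {S Ω : Type*} [MeasurableSpace Ω] {q : S → S → ℝ} {x : S}
  {P : Measure Ω} {Y : ℕ → Ω → S} {E : ℕ → Ω → ℝ≥0∞}

/-- There are countably many trajectories of the first n + 1 states, so the identity can be checked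
on each; those not starting at x are null. -/
theorem measure_eq_mul_of_path [Countable S] (hX : IsMinimalChain q x P Y E) (n : ℕ) {A B : Set Ω}
    (hA : MeasurableSet A) (hB : MeasurableSet B) (c : ℝ≥0∞)
    (h : ∀ s : ℕ → S, s 0 = x →
      P (A ∩ {ω | ∀ k ≤ n, Y k ω = s k}) = P (B ∩ {ω | ∀ k ≤ n, Y k ω = s k}) * c) :
    P A = P B * c := by
  let C : (Fin (n + 1) → S) → Set Ω := fun s => {ω | ∀ k, Y (k : Fin (n + 1)) ω = s k}
  have hC : ∀ s, MeasurableSet (C s) := fun s => by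
    have : C s = ⋂ k, {ω | Y (k : Fin (n + 1)) ω = s k} := by ext; simp [C]
    rw [this]
    exact MeasurableSet.iInter fun k => hX.measurableSet_state _ _
  have hdisj : Pairwise (Function.onFun Disjoint C) := by
    intro s s' hs
    refine Set.disjoint_left.2 fun ω h1 h2 => hs (funext fun k => ?_)
    rw [← h1 k, ← h2 k]
  have hsum : ∀ D : Set Ω, MeasurableSet D → P D = ∑' s, P (D ∩ C s) := by
    intro D hD
    rw [← measure_iUnion (fun s s' hs => (hdisj hs).mono Set.inter_subset_right
      Set.inter_subset_right) fun s => hD.inter (hC s), ← Set.inter_iUnion]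
    congr 1
    refine (Set.inter_eq_left.2 fun ω _ => Set.mem_iUnion.2 ⟨fun k : Fin (n + 1) => Y k ω, ?_⟩).symm
    exact Set.mem_ofPred.2 fun k => rfl
  rw [hsum A hA, hsum B hB, ← ENNReal.tsum_mul_right]
  refine tsum_congr fun s => ?_
  by_cases hs : s 0 = x
  · have hCs : C s = {ω | ∀ k ≤ n, Y k ω = s (Fin.ofNat (n + 1) k)} := by
      ext ω
      constructor
      · intro h k hk
        have := h (Fin.ofNat (n + 1) k)
        rwa [Fin.val_ofNat, Nat.mod_eq_of_lt (by omega)] at this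
      · intro h k
        have := h k (by omega)
        rwa [Fin.ofNat_val_eq_self] at this
    rw [hCs]
    exact h (fun k => s (Fin.ofNat (n + 1) k)) hs
  · have h0 : P (C s) = 0 := by
      refine measure_mono_null ?_ hX.start
      intro ω hω h0
      exact hs ((hω 0).symm.trans h0)
    rw [measure_mono_null Set.inter_subset_right h0, measure_mono_null Set.inter_subset_right h0,
      zero_mul]

theorem measurableSet_pos (hX : IsMinimalChain q x P Y E) (n : ℕ) :
    MeasurableSet {ω | ∀ k ≤ n, 0 < E k ω} := by
  have : {ω | ∀ k ≤ n, 0 < E k ω} = ⋂ k, ⋂ (_ : k ≤ n), {ω | 0 < E k ω} := by ext; simp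
  rw [this]
  exact MeasurableSet.iInter fun k => MeasurableSet.iInter fun _ =>
    measurableSet_lt measurable_const (hX.measurable_time k)

/-- This is `law` at times zero. The condition `0 < E k` remains in the event, so the Markov
property is first proved with it, until `ae_time_pos` removes it. -/
theorem measure_path_pos (hX : IsMinimalChain q x P Y E) (n : ℕ) (s : ℕ → S) (hs : s 0 = x) :
    P {ω | ∀ k ≤ n, Y k ω = s k ∧ 0 < E k ω} =
      ENNReal.ofReal (∏ k ∈ Finset.range n, jumpProb q (s k) (s (k + 1))) := by
  have := hX.law n s 0 hs
  simpa using this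

variable [Countable S]

theorem measure_step_pos (hX : IsMinimalChain q x P Y E)
    (hj : ∀ a b, 0 ≤ jumpProb q a b) (n : ℕ) (a b : S) :
    P {ω | Y n ω = a ∧ Y (n + 1) ω = b ∧ ∀ k ≤ n + 1, 0 < E k ω} =
      P {ω | Y n ω = a ∧ ∀ k ≤ n, 0 < E k ω} * ENNReal.ofReal (jumpProb q a b) := by
  refine measure_eq_mul_of_path hX n ?_ ?_ _ fun s hs => ?_
  · exact (hX.measurableSet_state _ _).inter
      ((hX.measurableSet_state _ _).inter (measurableSet_pos hX _))
  · exact (hX.measurableSet_state _ _).inter (measurableSet_pos hX _)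
  by_cases ha : s n = a
  · subst ha
    let s' := Function.update s (n + 1) b
    have hs' : ∀ k ≤ n, s' k = s k := fun k hk => Function.update_of_ne (by omega) _ _
    have hb : s' (n + 1) = b := Function.update_self _ _ _
    have h1 := measure_path_pos hX (n + 1) s' (by rw [hs' 0 (Nat.zero_le _), hs])
    have h2 := measure_path_pos hX n s hs
    rw [Finset.prod_range_succ, ENNReal.ofReal_mul (Finset.prod_nonneg fun _ _ => hj _ _),
      hs' n le_rfl, hb, Finset.prod_congr rfl (g := fun k => jumpProb q (s k) (s (k + 1)))
        (fun k hk => by rw [hs' k (by simp at hk; omega), hs' (k + 1) (by simp at hk; omega)]),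
      ← h2] at h1
    convert h1 using 2
    · ext ω
      simp only [Set.mem_inter_iff, Set.mem_ofPred_eq]
      constructor
      · rintro ⟨⟨-, h1, h2⟩, h3⟩ k hk
        refine ⟨?_, h2 k hk⟩
        rcases Nat.lt_or_ge n k with h | h
        · obtain rfl : k = n + 1 := by omega
          rw [h1, hb]
        · rw [hs' k h, h3 k h]
      · intro h
        refine ⟨⟨?_, ?_, fun k hk => (h k hk).2⟩, fun k hk => ?_⟩
        · rw [(h n (by omega)).1, hs' n le_rfl]
        · rw [(h (n + 1) le_rfl).1, hb]
        · rw [(h k (by omega)).1, hs' k hk]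
    · congr 1
      ext ω
      simp only [Set.mem_inter_iff, Set.mem_ofPred_eq]
      exact ⟨fun h k hk => ⟨h.2 k hk, h.1.2 k hk⟩,
        fun h => ⟨⟨(h n le_rfl).1, fun k hk => (h k hk).2⟩, fun k hk => (h k hk).1⟩⟩
  · have : ∀ D : Set Ω, P ({ω | Y n ω = a ∧ ω ∈ D} ∩ {ω | ∀ k ≤ n, Y k ω = s k}) = 0 := by
      intro D
      convert measure_empty (μ := P)
      ext ω
      simp only [Set.mem_inter_iff, Set.mem_ofPred_eq, Set.mem_empty_iff_false, iff_false]
      rintro ⟨⟨h, -⟩, h'⟩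
      exact ha ((h' n le_rfl).symm.trans h)
    have h1 := this {ω | Y (n + 1) ω = b ∧ ∀ k ≤ n + 1, 0 < E k ω}
    have h2 := this {ω | ∀ k ≤ n, 0 < E k ω}
    simp only [Set.mem_ofPred_eq] at h1 h2
    rw [h1, h2, zero_mul]

theorem measure_hold_pos (hX : IsMinimalChain q x P Y E)
    (hj : ∀ a b, 0 ≤ jumpProb q a b) (n : ℕ) (a : S) (t : ℝ≥0) :
    P {ω | Y n ω = a ∧ (t : ℝ≥0∞) < E n ω ∧ ∀ k ≤ n, 0 < E k ω} =
      P {ω | Y n ω = a ∧ ∀ k ≤ n, 0 < E k ω} * ENNReal.ofReal (Real.exp (q a a * t)) := by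
  refine measure_eq_mul_of_path hX n ?_ ?_ _ fun s hs => ?_
  · exact (hX.measurableSet_state _ _).inter
      ((measurableSet_lt measurable_const (hX.measurable_time n)).inter (measurableSet_pos hX _))
  · exact (hX.measurableSet_state _ _).inter (measurableSet_pos hX _)
  by_cases ha : s n = a
  · subst ha
    -- Only the n-th threshold is nonzero, so a single exponential factor survives.
    have h1 := hX.law n s (Function.update 0 n t) hs
    have h2 := measure_path_pos hX n s hs
    rw [ENNReal.ofReal_mul (Finset.prod_nonneg fun _ _ => hj _ _), ← h2,
      Finset.prod_range_succ, Finset.prod_eq_one, one_mul, Function.update_self] at h1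
    · convert h1 using 2
      · ext ω
        simp only [Set.mem_inter_iff, Set.mem_ofPred_eq]
        constructor
        · rintro ⟨⟨-, h1, h2⟩, h3⟩ k hk
          refine ⟨h3 k hk, ?_⟩
          rcases eq_or_ne k n with rfl | h
          · rwa [Function.update_self]
          · simpa [Function.update_of_ne h] using h2 k hk
        · intro h
          have hn := (h n le_rfl).2
          rw [Function.update_self] at hn
          refine ⟨⟨(h n le_rfl).1, hn, fun k hk => bot_le.trans_lt (h k hk).2⟩,
            fun k hk => (h k hk).1⟩
      · congr 1
        ext ω
        simp only [Set.mem_inter_iff, Set.mem_ofPred_eq]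
        exact ⟨fun h k hk => ⟨h.2 k hk, h.1.2 k hk⟩,
          fun h => ⟨⟨(h n le_rfl).1, fun k hk => (h k hk).2⟩, fun k hk => (h k hk).1⟩⟩
    · intro k hk
      rw [Function.update_of_ne (by simp at hk; omega)]
      simp
  · have : ∀ D : Set Ω, P ({ω | Y n ω = a ∧ ω ∈ D} ∩ {ω | ∀ k ≤ n, Y k ω = s k}) = 0 := by
      intro D
      convert measure_empty (μ := P)
      ext ω
      simp only [Set.mem_inter_iff, Set.mem_ofPred_eq, Set.mem_empty_iff_false, iff_false]
      rintro ⟨⟨h, -⟩, h'⟩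
      exact ha ((h' n le_rfl).symm.trans h)
    have h1 := this {ω | (t : ℝ≥0∞) < E n ω ∧ ∀ k ≤ n, 0 < E k ω}
    have h2 := this {ω | ∀ k ≤ n, 0 < E k ω}
    simp only [Set.mem_ofPred_eq] at h1 h2
    rw [h1, h2, zero_mul]

theorem measure_eq_tsum_state (hX : IsMinimalChain q x P Y E) (n : ℕ) {D : Set Ω}
    (hD : MeasurableSet D) : P D = ∑' a, P {ω | Y n ω = a ∧ ω ∈ D} := by
  rw [← measure_iUnion]
  · congr 1
    ext ω
    simp
  · intro a b hab
    refine Set.disjoint_left.2 fun ω h1 h2 => hab ?_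
    rw [← h1.1, ← h2.1]
  · exact fun a => (hX.measurableSet_state _ _).inter hD

variable [IsProbabilityMeasure P]

/-- Since the rows of the jump matrix sum to one, summing `measure_step_pos` over both states shows
that no mass is lost from n to n + 1. -/
theorem measure_pos_eq_one (hX : IsMinimalChain q x P Y E) (hj : ∀ a b, 0 ≤ jumpProb q a b)
    (hrow : ∀ a, ∑' b, ENNReal.ofReal (jumpProb q a b) = 1) (n : ℕ) :
    P {ω | ∀ k ≤ n, 0 < E k ω} = 1 := by
  induction n with
  | zero =>
    refine le_antisymm prob_le_one ?_
    have := measure_path_pos hX 0 (fun _ => x) rfl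
    simp only [Finset.range_zero, Finset.prod_empty, ENNReal.ofReal_one] at this
    rw [← this]
    exact measure_mono fun ω h k hk => (h k hk).2
  | succ n ih =>
    rw [measure_eq_tsum_state hX n (measurableSet_pos hX _), ← ih,
      measure_eq_tsum_state hX n (measurableSet_pos hX _)]
    refine tsum_congr fun a => ?_
    have hm : MeasurableSet {ω | Y n ω = a ∧ ∀ k ≤ n + 1, 0 < E k ω} :=
      (hX.measurableSet_state n a).inter (measurableSet_pos hX _)
    simp only [Set.mem_ofPred_eq]
    rw [measure_eq_tsum_state hX (n + 1) hm]
    have : ∀ b, {ω | Y (n + 1) ω = b ∧ ω ∈ {ω | Y n ω = a ∧ ∀ k ≤ n + 1, 0 < E k ω}} =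
        {ω | Y n ω = a ∧ Y (n + 1) ω = b ∧ ∀ k ≤ n + 1, 0 < E k ω} := by
      intro b; ext ω; simp only [Set.mem_ofPred_eq]; tauto
    simp only [this, measure_step_pos hX hj, ENNReal.tsum_mul_left, hrow, mul_one]

theorem ae_time_pos (hX : IsMinimalChain q x P Y E) (hj : ∀ a b, 0 ≤ jumpProb q a b)
    (hrow : ∀ a, ∑' b, ENNReal.ofReal (jumpProb q a b) = 1) : ∀ᵐ ω ∂P, ∀ k, 0 < E k ω := by
  rw [ae_all_iff]
  intro n
  have := (prob_compl_eq_zero_iff (measurableSet_pos hX n)).2 (measure_pos_eq_one hX hj hrow n)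
  filter_upwards [compl_mem_ae_iff.2 this] with ω hω
  simp only [compl_compl, Set.mem_ofPred_eq] at hω
  exact hω n le_rfl

theorem measure_step (hX : IsMinimalChain q x P Y E) (hj : ∀ a b, 0 ≤ jumpProb q a b)
    (hrow : ∀ a, ∑' b, ENNReal.ofReal (jumpProb q a b) = 1) (n : ℕ) (a b : S) :
    P {ω | Y n ω = a ∧ Y (n + 1) ω = b} =
      P {ω | Y n ω = a} * ENNReal.ofReal (jumpProb q a b) := by
  have hpos := ae_time_pos hX hj hrow
  have h := measure_step_pos hX hj n a b
  have h1 : {ω | Y n ω = a ∧ Y (n + 1) ω = b} =ᵐ[P]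
      {ω | Y n ω = a ∧ Y (n + 1) ω = b ∧ ∀ k ≤ n + 1, 0 < E k ω} := by
    filter_upwards [hpos] with ω hω
    exact propext ⟨fun h => ⟨h.1, h.2, fun k _ => hω k⟩, fun h => ⟨h.1, h.2.1⟩⟩
  have h2 : {ω | Y n ω = a} =ᵐ[P] {ω | Y n ω = a ∧ ∀ k ≤ n, 0 < E k ω} := by
    filter_upwards [hpos] with ω hω
    exact propext ⟨fun h => ⟨h, fun k _ => hω k⟩, fun h => h.1⟩
  rw [measure_congr h1, measure_congr h2, h]

theorem measure_hold (hX : IsMinimalChain q x P Y E) (hj : ∀ a b, 0 ≤ jumpProb q a b)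
    (hrow : ∀ a, ∑' b, ENNReal.ofReal (jumpProb q a b) = 1) (n : ℕ) (a : S) (t : ℝ≥0) :
    P {ω | Y n ω = a ∧ (t : ℝ≥0∞) < E n ω} =
      P {ω | Y n ω = a} * ENNReal.ofReal (Real.exp (q a a * t)) := by
  have hpos := ae_time_pos hX hj hrow
  have h := measure_hold_pos hX hj n a t
  have h1 : {ω | Y n ω = a ∧ (t : ℝ≥0∞) < E n ω} =ᵐ[P]
      {ω | Y n ω = a ∧ (t : ℝ≥0∞) < E n ω ∧ ∀ k ≤ n, 0 < E k ω} := by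
    filter_upwards [hpos] with ω hω
    exact propext ⟨fun h => ⟨h.1, h.2, fun k _ => hω k⟩, fun h => ⟨h.1, h.2.1⟩⟩
  have h2 : {ω | Y n ω = a} =ᵐ[P] {ω | Y n ω = a ∧ ∀ k ≤ n, 0 < E k ω} := by
    filter_upwards [hpos] with ω hω
    exact propext ⟨fun h => ⟨h, fun k _ => hω k⟩, fun h => h.1⟩
  rw [measure_congr h1, measure_congr h2, h]

theorem ae_time_lt_top (hX : IsMinimalChain q x P Y E) (hj : ∀ a b, 0 ≤ jumpProb q a b)
    (hrow : ∀ a, ∑' b, ENNReal.ofReal (jumpProb q a b) = 1) :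
    ∀ᵐ ω ∂P, ∀ n, q (Y n ω) (Y n ω) < 0 → E n ω < ∞ := by
  rw [ae_all_iff]
  intro n
  have : ∀ᵐ ω ∂P, ∀ a, q a a < 0 → Y n ω = a → E n ω < ∞ := by
    rw [ae_all_iff]
    intro a
    by_cases ha : q a a < 0
    · suffices h : P {ω | Y n ω = a ∧ E n ω = ∞} = 0 by
        filter_upwards [measure_eq_zero_iff_ae_notMem.1 h] with ω hω _ h1
        exact lt_top_iff_ne_top.2 fun h2 => hω ⟨h1, h2⟩
      have hlim : Tendsto (fun m : ℕ => ENNReal.ofReal (Real.exp (q a a * m))) atTop (𝓝 0) := by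
        rw [← ENNReal.ofReal_zero]
        refine ENNReal.tendsto_ofReal (Real.tendsto_exp_atBot.comp ?_)
        exact tendsto_natCast_atTop_atTop.const_mul_atTop_of_neg ha
      refine le_antisymm (ge_of_tendsto' hlim fun m => ?_) bot_le
      calc P {ω | Y n ω = a ∧ E n ω = ∞}
          ≤ P {ω | Y n ω = a ∧ (((m : ℝ≥0) : ℝ≥0) : ℝ≥0∞) < E n ω} :=
            measure_mono fun ω h => ⟨h.1, by rw [h.2]; exact ENNReal.coe_lt_top⟩
        _ ≤ _ := by
          rw [measure_hold hX hj hrow]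
          simpa using mul_le_mul_left (prob_le_one (μ := P) (s := {ω | Y n ω = a}))
            (ENNReal.ofReal (Real.exp (q a a * m)))
    · exact .of_forall fun ω h => absurd h ha
  filter_upwards [this] with ω hω h
  exact hω _ h rfl

theorem ae_time_eq_top (hX : IsMinimalChain q x P Y E) (hj : ∀ a b, 0 ≤ jumpProb q a b)
    (hrow : ∀ a, ∑' b, ENNReal.ofReal (jumpProb q a b) = 1) {a : S} (ha : q a a = 0) :
    ∀ᵐ ω ∂P, ∀ n, Y n ω = a → E n ω = ∞ := by
  rw [ae_all_iff]
  intro n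
  have : ∀ᵐ ω ∂P, ∀ m : ℕ, Y n ω = a → (((m : ℝ≥0) : ℝ≥0) : ℝ≥0∞) < E n ω := by
    rw [ae_all_iff]
    intro m
    -- At rate zero the exponential factor is one, so exceeding m has full mass within `{Y n = a}`.
    have h1 := measure_hold hX hj hrow n a m
    simp only [ha, zero_mul, Real.exp_zero, ENNReal.ofReal_one, mul_one] at h1
    have h2 := ae_eq_of_subset_of_measure_ge
      (show {ω | Y n ω = a ∧ (((m : ℝ≥0) : ℝ≥0) : ℝ≥0∞) < E n ω} ⊆ {ω | Y n ω = a} from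
        fun ω h => h.1) h1.ge
      ((hX.measurableSet_state _ _).inter
        (measurableSet_lt measurable_const (hX.measurable_time n))).nullMeasurableSet
      (measure_ne_top _ _)
    filter_upwards [h2.mem_iff] with ω hω h
    exact (hω.2 h).2
  filter_upwards [this] with ω hω h
  refine ENNReal.eq_top_of_forall_nnreal_le fun t => ?_
  obtain ⟨m, hm⟩ := exists_nat_ge t
  exact (ENNReal.coe_le_coe.2 hm).trans (hω m h).le

theorem ae_jumpProb_ne_zero (hX : IsMinimalChain q x P Y E) (hj : ∀ a b, 0 ≤ jumpProb q a b)
    (hrow : ∀ a, ∑' b, ENNReal.ofReal (jumpProb q a b) = 1) :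
    ∀ᵐ ω ∂P, ∀ n, jumpProb q (Y n ω) (Y (n + 1) ω) ≠ 0 := by
  have : ∀ᵐ ω ∂P, ∀ n a b, jumpProb q a b = 0 → ¬ (Y n ω = a ∧ Y (n + 1) ω = b) := by
    simp only [ae_all_iff]
    intro n a b hab
    have h0 : P {ω | Y n ω = a ∧ Y (n + 1) ω = b} = 0 := by
      rw [measure_step hX hj hrow, hab, ENNReal.ofReal_zero, mul_zero]
    exact measure_eq_zero_iff_ae_notMem.1 h0
  filter_upwards [this] with ω hω n h
  exact hω n _ _ h ⟨rfl, rfl⟩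

end Chain

/-! ### Jump probabilities of the tree chain -/

section Generator

variable {I : Type*} {T : SimpleGraph I} {r : I} {w : ℕ → ℝ}

theorem increment_pos (hpos : ∀ n, 0 < w n) (hw : StrictMono w) (k : ℕ) : 0 < increment w k := by
  cases k with
  | zero => exact hpos 0
  | succ k => exact sub_pos.2 (hw (Nat.lt_succ_self k))

/-- The total jump rate out of a vertex. -/
noncomputable def rate (T : SimpleGraph I) (r : I) (w : ℕ → ℝ) (i : I) : ℝ :=
  (increment w (level T r i))⁻¹
    + ((successors T r i).ncard : ℝ) * (increment w (level T r i + 1))⁻¹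

theorem rate_pos (hpos : ∀ n, 0 < w n) (hw : StrictMono w) (i : I) : 0 < rate T r w i := by
  have h1 := increment_pos hpos hw (level T r i)
  have h2 := increment_pos hpos hw (level T r i + 1)
  unfold rate
  positivity

theorem generator_self (i : I) : generator T r w (some i) (some i) = -rate T r w i := by
  simp [generator, rate]

theorem jumpProb_none_none : jumpProb (generator T r w) none none = 1 := by
  simp [jumpProb, generator]

theorem jumpProb_none_some (j : I) : jumpProb (generator T r w) none (some j) = 0 := by
  simp [jumpProb, generator]

theorem jumpProb_some_none (hpos : ∀ n, 0 < w n) (hw : StrictMono w) (i : I) [Decidable (i = r)] :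
    jumpProb (generator T r w) (some i) none = if i = r then (w 0)⁻¹ / rate T r w i else 0 := by
  have h := (rate_pos (T := T) (r := r) hpos hw i).ne'
  rw [jumpProb, generator_self, neg_neg, if_neg (neg_ne_zero.2 h), if_neg (by simp)]
  simp only [generator]
  split_ifs <;> simp

theorem jumpProb_of_adj (hpos : ∀ n, 0 < w n) (hw : StrictMono w) {i j : I} (h : T.Adj i j) :
    jumpProb (generator T r w) (some i) (some j) =
      (increment w (max (level T r i) (level T r j)))⁻¹ / rate T r w i := by
  have h' := (rate_pos (T := T) (r := r) hpos hw i).ne'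
  rw [jumpProb, generator_self, neg_neg, if_neg (neg_ne_zero.2 h'), if_neg (by simpa using h.ne)]
  simp [generator, h, h.ne]

theorem jumpProb_of_not_adj (hpos : ∀ n, 0 < w n) (hw : StrictMono w) {i j : I}
    (h : ¬ T.Adj i j) : jumpProb (generator T r w) (some i) (some j) = 0 := by
  have h' := (rate_pos (T := T) (r := r) hpos hw i).ne'
  rw [jumpProb, generator_self, neg_neg, if_neg (neg_ne_zero.2 h')]
  split_ifs with h2
  · rfl
  · simp [generator, h, show i ≠ j by simpa using h2]

theorem IsChild.jumpProb_up (hpos : ∀ n, 0 < w n) (hw : StrictMono w) {u v : I}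
    (h : IsChild T r u v) : jumpProb (generator T r w) (some u) (some v) =
      (increment w (level T r v))⁻¹ / rate T r w u := by
  rw [jumpProb_of_adj hpos hw h.1, max_eq_right (by have := h.2; omega)]

theorem IsChild.jumpProb_down (hpos : ∀ n, 0 < w n) (hw : StrictMono w) {u v : I}
    (h : IsChild T r u v) : jumpProb (generator T r w) (some v) (some u) =
      (increment w (level T r v))⁻¹ / rate T r w v := by
  rw [jumpProb_of_adj hpos hw h.1.symm, max_eq_left (by have := h.2; omega)]

theorem jumpProb_nonneg (hpos : ∀ n, 0 < w n) (hw : StrictMono w) (a b : Option I) :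
    0 ≤ jumpProb (generator T r w) a b := by
  classical
  have hr := fun i => (rate_pos (T := T) (r := r) hpos hw i).le
  match a, b with
  | none, none => rw [jumpProb_none_none]; exact zero_le_one
  | none, some j => rw [jumpProb_none_some]
  | some i, none =>
    rw [jumpProb_some_none hpos hw]
    split_ifs
    · exact div_nonneg (inv_nonneg.2 (hpos 0).le) (hr i)
    · exact le_rfl
  | some i, some j =>
    by_cases h : T.Adj i j
    · rw [jumpProb_of_adj hpos hw h]
      exact div_nonneg (inv_nonneg.2 (increment_pos hpos hw _).le) (hr i)
    · rw [jumpProb_of_not_adj hpos hw h]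

theorem tsum_jumpProb (hT : T.IsTree) (hfin : ∀ i, (T.neighborSet i).Finite)
    (hpos : ∀ n, 0 < w n) (hw : StrictMono w) (a : Option I) :
    ∑' b, ENNReal.ofReal (jumpProb (generator T r w) a b) = 1 := by
  classical
  match a with
  | none =>
    rw [tsum_eq_single none]
    · rw [jumpProb_none_none, ENNReal.ofReal_one]
    · rintro (_ | j) hj
      · exact absurd rfl hj
      · rw [jumpProb_none_some, ENNReal.ofReal_zero]
  | some i =>
    have hsucc : (successors T r i).Finite := (hfin i).subset fun j hj => hj.1
    -- Here d is the target on the root side: ∂_r for i = r, the parent otherwise. Its rate is the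
    -- first summand of `rate` in both cases, as Δ_0(w) = w_0.
    obtain ⟨d, hd, hdj, hdall⟩ : ∃ d : Option I, (∀ j, IsChild T r i j → d ≠ some j) ∧
        jumpProb (generator T r w) (some i) d =
          (increment w (level T r i))⁻¹ / rate T r w i ∧
        ∀ b, jumpProb (generator T r w) (some i) b ≠ 0 → b ≠ d → ∃ j, IsChild T r i j ∧ b = some j := by
      by_cases hi : i = r
      · refine ⟨none, by simp, ?_, ?_⟩
        · rw [jumpProb_some_none hpos hw, if_pos hi, hi, level_root]; rfl
        · rintro (_ | j) hj hne
          · exact absurd rfl hne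
          · have hadj : T.Adj i j := by
              by_contra h; exact hj (jumpProb_of_not_adj hpos hw h)
            refine ⟨j, (IsChild.of_adj hT hadj).resolve_right fun h => ?_, rfl⟩
            have := h.2
            rw [hi, level_root] at this
            omega
      · obtain ⟨u, hu⟩ := exists_parent hT hi
        refine ⟨some u, ?_, hu.jumpProb_down hpos hw, ?_⟩
        · rintro j hj h
          obtain rfl : u = j := by simpa using h
          have := hj.2; have := hu.2; omega
        · rintro (_ | j) hj hne
          · rw [jumpProb_some_none hpos hw, if_neg hi] at hj; exact absurd rfl hj
          · have hadj : T.Adj i j := by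
              by_contra h; exact hj (jumpProb_of_not_adj hpos hw h)
            exact ⟨j, (IsChild.of_adj hT hadj).resolve_right fun h =>
              hne (by rw [h.unique hT hu]), rfl⟩
    have hmem : ∀ j, j ∈ hsucc.toFinset ↔ IsChild T r i j := fun j => by
      rw [Set.Finite.mem_toFinset, mem_successors_iff hT]
    have hnot : d ∉ hsucc.toFinset.image some := by
      intro h
      obtain ⟨j, hj, rfl⟩ := Finset.mem_image.1 h
      exact hd j ((hmem j).1 hj) rfl
    rw [tsum_eq_sum (s := insert d (hsucc.toFinset.image some))]
    · rw [← ENNReal.ofReal_sum_of_nonneg fun _ _ => jumpProb_nonneg hpos hw _ _,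
        Finset.sum_insert hnot, Finset.sum_image (by simp), hdj,
        Finset.sum_congr rfl (g := fun _ => (increment w (level T r i + 1))⁻¹ / rate T r w i)
          (fun j hj => by
            have h := (hmem j).1 hj
            rw [h.jumpProb_up hpos hw, h.2]),
        Finset.sum_const, nsmul_eq_mul, ← Set.ncard_eq_toFinset_card _ hsucc, mul_div_assoc',
        ← add_div]
      change ENNReal.ofReal (rate T r w i / rate T r w i) = 1
      rw [div_self (rate_pos hpos hw i).ne', ENNReal.ofReal_one]
    · intro b hb
      rw [Finset.mem_insert, not_or] at hb
      by_contra h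
      obtain ⟨j, hj, rfl⟩ := hdall b (fun h' => h (by rw [h', ENNReal.ofReal_zero])) hb.1
      exact hb.2 (Finset.mem_image_of_mem _ ((hmem j).2 hj))

end Generator

/-! ### Flux identities -/

section Flux

variable {I Ω : Type*} {T : SimpleGraph I} {r : I} {w : ℕ → ℝ} {Y : ℕ → Ω → Option I}

/-- The event that the chain is in the branch of `v` after `n` jumps. -/
def inBranch (T : SimpleGraph I) (r : I) (Y : ℕ → Ω → Option I) (v : I) (n : ℕ) : Set Ω :=
  {ω | ∃ j, Y n ω = some j ∧ Prec T r v j}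

theorem mem_inBranch_root (hT : T.IsTree) {n : ℕ} {ω : Ω} :
    ω ∈ inBranch T r Y r n ↔ Y n ω ≠ none := by
  rw [Option.ne_none_iff_exists']
  exact ⟨fun ⟨j, hj, _⟩ => ⟨j, hj⟩, fun ⟨j, hj⟩ => ⟨j, hj, root_prec hT j⟩⟩

variable [MeasurableSpace Ω] {P : Measure Ω} {E : ℕ → Ω → ℝ≥0∞}

theorem measurableSet_inBranch [Countable I] (hX : IsMinimalChain (generator T r w) (some r) P Y E)
    (v : I) (n : ℕ) : MeasurableSet (inBranch T r Y v n) := by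
  have : inBranch T r Y v n = ⋃ j ∈ {j | Prec T r v j}, {ω | Y n ω = some j} := by
    ext ω; simp [inBranch, and_comm]
  rw [this]
  exact MeasurableSet.biUnion (Set.to_countable _) fun j _ => hX.measurableSet_state _ _

/-- The admissible transitions of the chain: along edges, from `r` to `∂_r`, or staying at `∂_r`. -/
def GoodStep (T : SimpleGraph I) (r : I) (a b : Option I) : Prop :=
  (∃ i j, a = some i ∧ b = some j ∧ T.Adj i j) ∨ (a = some r ∧ b = none) ∨ (a = none ∧ b = none)

theorem goodStep_of_jumpProb_ne_zero (hpos : ∀ n, 0 < w n) (hw : StrictMono w) {a b : Option I}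
    (h : jumpProb (generator T r w) a b ≠ 0) : GoodStep T r a b := by
  classical
  match a, b with
  | none, none => exact .inr (.inr ⟨rfl, rfl⟩)
  | none, some j => exact absurd (jumpProb_none_some j) h
  | some i, none =>
    rw [jumpProb_some_none hpos hw] at h
    exact .inr (.inl ⟨by rw [(ite_ne_right_iff.1 h).1], rfl⟩)
  | some i, some j =>
    refine .inl ⟨i, j, rfl, rfl, ?_⟩
    by_contra h'
    exact h (jumpProb_of_not_adj hpos hw h')

theorem real_sub_real_eq [IsFiniteMeasure P] {A B C D : Set Ω} (hA : MeasurableSet A)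
    (hB : MeasurableSet B) (h1 : (A \ B : Set Ω) =ᵐ[P] C) (h2 : (B \ A : Set Ω) =ᵐ[P] D) :
    P.real A - P.real B = P.real C - P.real D := by
  rw [← measureReal_congr h1, ← measureReal_congr h2, ← measureReal_sdiff_add_inter hB (s := A),
    ← measureReal_sdiff_add_inter hA (s := B), Set.inter_comm B A]
  ring

theorem real_inBranch_zero [IsProbabilityMeasure P] (hT : T.IsTree)
    (hX : IsMinimalChain (generator T r w) (some r) P Y E) (v : I) [Decidable (v = r)] :
    P.real (inBranch T r Y v 0) = if v = r then 1 else 0 := by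
  have : (inBranch T r Y v 0 : Set Ω) =ᵐ[P] {_ω | v = r} := by
    filter_upwards [hX.start] with ω hω
    refine propext ⟨?_, fun h => ⟨r, hω, (prec_root_right hT).2 h⟩⟩
    rintro ⟨j, hj, hvj⟩
    obtain rfl : r = j := by simpa using hω.symm.trans hj
    exact (prec_root_right hT).1 hvj
  rw [measureReal_congr this]
  split_ifs with h <;> simp [h]

variable [Countable I] [IsProbabilityMeasure P]

theorem ae_goodStep (hT : T.IsTree) (hfin : ∀ i, (T.neighborSet i).Finite)
    (hpos : ∀ n, 0 < w n) (hw : StrictMono w)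
    (hX : IsMinimalChain (generator T r w) (some r) P Y E) :
    ∀ᵐ ω ∂P, ∀ n, GoodStep T r (Y n ω) (Y (n + 1) ω) := by
  filter_upwards [ae_jumpProb_ne_zero hX (jumpProb_nonneg hpos hw) (tsum_jumpProb hT hfin hpos hw)]
    with ω hω n
  exact goodStep_of_jumpProb_ne_zero hpos hw (hω n)

theorem real_step (hT : T.IsTree) (hfin : ∀ i, (T.neighborSet i).Finite)
    (hpos : ∀ n, 0 < w n) (hw : StrictMono w)
    (hX : IsMinimalChain (generator T r w) (some r) P Y E) (n : ℕ) (a b : Option I) :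
    P.real {ω | Y n ω = a ∧ Y (n + 1) ω = b} =
      P.real {ω | Y n ω = a} * jumpProb (generator T r w) a b := by
  rw [measureReal_def, measure_step hX (jumpProb_nonneg hpos hw) (tsum_jumpProb hT hfin hpos hw),
    ENNReal.toReal_mul, ENNReal.toReal_ofReal (jumpProb_nonneg hpos hw _ _), measureReal_def]

/-- The branch of v is entered by the jump from u to v and left by the jump from v to u; multiplying
by Δ cancels the common rate of these two jumps. -/
theorem flux_child (hT : T.IsTree) (hfin : ∀ i, (T.neighborSet i).Finite)
    (hpos : ∀ n, 0 < w n) (hw : StrictMono w)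
    (hX : IsMinimalChain (generator T r w) (some r) P Y E) {u v : I} (h : IsChild T r u v) (n : ℕ) :
    increment w (level T r v) *
        (P.real (inBranch T r Y v (n + 1)) - P.real (inBranch T r Y v n)) =
      P.real {ω | Y n ω = some u} / rate T r w u - P.real {ω | Y n ω = some v} / rate T r w v := by
  have hstep := ae_goodStep hT hfin hpos hw hX
  have hvr : v ≠ r := by rintro rfl; have := h.2; rw [level_root] at this; omega
  have h1 : (inBranch T r Y v (n + 1) \ inBranch T r Y v n : Set Ω) =ᵐ[P]
      {ω | Y n ω = some u ∧ Y (n + 1) ω = some v} := by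
    filter_upwards [hstep] with ω hω
    refine propext ⟨?_, ?_⟩
    · rintro ⟨⟨j, hj, hvj⟩, hn⟩
      rcases hω n with ⟨x, y, hx, hy, hxy⟩ | ⟨hx, hy⟩ | ⟨hx, hy⟩
      · obtain rfl : y = j := by simpa using hy.symm.trans hj
        obtain ⟨rfl, hc⟩ := hvj.eq_of_adj_of_not hT hxy.symm fun h' => hn ⟨x, hx, h'⟩
        obtain rfl := hc.unique hT h
        exact ⟨hx, hy⟩
      · simp [hy] at hj
      · simp [hy] at hj
    · rintro ⟨hx, hy⟩
      refine ⟨⟨v, hy, prec_refl hT v⟩, ?_⟩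
      rintro ⟨j, hj, hvj⟩
      obtain rfl : u = j := by simpa using hx.symm.trans hj
      exact h.not_prec hT hvj
  have h2 : (inBranch T r Y v n \ inBranch T r Y v (n + 1) : Set Ω) =ᵐ[P]
      {ω | Y n ω = some v ∧ Y (n + 1) ω = some u} := by
    filter_upwards [hstep] with ω hω
    refine propext ⟨?_, ?_⟩
    · rintro ⟨⟨j, hj, hvj⟩, hn⟩
      rcases hω n with ⟨x, y, hx, hy, hxy⟩ | ⟨hx, hy⟩ | ⟨hx, hy⟩
      · obtain rfl : x = j := by simpa using hx.symm.trans hj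
        obtain ⟨rfl, hc⟩ := hvj.eq_of_adj_of_not hT hxy fun h' => hn ⟨y, hy, h'⟩
        obtain rfl := hc.unique hT h
        exact ⟨hx, hy⟩
      · obtain rfl : r = j := by simpa using hx.symm.trans hj
        exact absurd ((prec_root_right hT).1 hvj) hvr
      · simp [hx] at hj
    · rintro ⟨hx, hy⟩
      refine ⟨⟨v, hx, prec_refl hT v⟩, ?_⟩
      rintro ⟨j, hj, hvj⟩
      obtain rfl : u = j := by simpa using hy.symm.trans hj
      exact h.not_prec hT hvj
  rw [real_sub_real_eq (measurableSet_inBranch hX _ _) (measurableSet_inBranch hX _ _) h1 h2,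
    real_step hT hfin hpos hw hX, real_step hT hfin hpos hw hX, h.jumpProb_up hpos hw,
    h.jumpProb_down hpos hw]
  have := (increment_pos hpos hw (level T r v)).ne'
  field_simp

/-- The branch of r is all of I: it is never re-entered, and it is left only by the jump from r to
∂_r. -/
theorem flux_root (hT : T.IsTree) (hfin : ∀ i, (T.neighborSet i).Finite)
    (hpos : ∀ n, 0 < w n) (hw : StrictMono w)
    (hX : IsMinimalChain (generator T r w) (some r) P Y E) (n : ℕ) :
    increment w 0 *
        (P.real (inBranch T r Y r (n + 1)) - P.real (inBranch T r Y r n)) =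
      - (P.real {ω | Y n ω = some r} / rate T r w r) := by
  classical
  have hstep := ae_goodStep hT hfin hpos hw hX
  have h1 : (inBranch T r Y r (n + 1) \ inBranch T r Y r n : Set Ω) =ᵐ[P] (∅ : Set Ω) := by
    filter_upwards [hstep] with ω hω
    refine propext ⟨?_, False.elim⟩
    rintro ⟨hy, hx⟩
    rw [mem_inBranch_root hT] at hx hy
    rw [not_not] at hx
    rcases hω n with ⟨x, y, hx', hy', hxy⟩ | ⟨hx', hy'⟩ | ⟨hx', hy'⟩
    · simp [hx'] at hx
    · exact hy hy'
    · exact hy hy'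
  have h2 : (inBranch T r Y r n \ inBranch T r Y r (n + 1) : Set Ω) =ᵐ[P]
      {ω | Y n ω = some r ∧ Y (n + 1) ω = none} := by
    filter_upwards [hstep] with ω hω
    refine propext ⟨?_, ?_⟩
    · rintro ⟨hx, hy⟩
      rw [mem_inBranch_root hT] at hx hy
      rw [not_not] at hy
      rcases hω n with ⟨x, y, hx', hy', hxy⟩ | h' | ⟨hx', hy'⟩
      · simp [hy'] at hy
      · exact h'
      · exact absurd hx' hx
    · rintro ⟨hx, hy⟩
      exact ⟨(mem_inBranch_root hT).2 (by simp [hx]), fun h' => (mem_inBranch_root hT).1 h' hy⟩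
  rw [real_sub_real_eq (measurableSet_inBranch hX _ _) (measurableSet_inBranch hX _ _) h1 h2,
    real_step hT hfin hpos hw hX, jumpProb_some_none hpos hw, if_pos rfl, measureReal_empty]
  have := (hpos 0).ne'
  simp only [increment]
  field_simp
  simp

/-- The right-hand sides of `flux_child` telescope along the geodesic, and `flux_root` supplies the
initial term. -/
theorem flux_end (hT : T.IsTree) (hfin : ∀ i, (T.neighborSet i).Finite)
    (hpos : ∀ n, 0 < w n) (hw : StrictMono w)
    (hX : IsMinimalChain (generator T r w) (some r) P Y E) (ξ : Ends T r) (n K : ℕ) :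
    ∑ k ∈ Finset.range (K + 1), increment w k *
        (P.real (inBranch T r Y (ξ k) (n + 1)) - P.real (inBranch T r Y (ξ k) n)) =
      - (P.real {ω | Y n ω = some (ξ K)} / rate T r w (ξ K)) := by
  induction K with
  | zero =>
    rw [Finset.sum_range_one, ξ.2.1]
    exact flux_root hT hfin hpos hw hX n
  | succ K ih =>
    have h := flux_child hT hfin hpos hw hX (ξ.isChild hT K) n
    rw [ξ.level_eq hT] at h
    rw [Finset.sum_range_succ, ih, h]
    ring

/-- The potential identity along an end. -/
theorem potential_end (hT : T.IsTree) (hfin : ∀ i, (T.neighborSet i).Finite)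
    (hpos : ∀ n, 0 < w n) (hw : StrictMono w)
    (hX : IsMinimalChain (generator T r w) (some r) P Y E) (ξ : Ends T r) (n K : ℕ) :
    ∑ k ∈ Finset.range (K + 1), increment w k * P.real (inBranch T r Y (ξ k) n) +
      ∑ l ∈ Finset.range n, P.real {ω | Y l ω = some (ξ K)} / rate T r w (ξ K) = w 0 := by
  classical
  induction n with
  | zero =>
    -- At time zero the chain is at r, so only k = 0 contributes, with Δ_0(w) = w_0.
    rw [Finset.sum_range_zero, add_zero, Finset.sum_range_succ']
    simp only [real_inBranch_zero hT hX]
    rw [if_pos ξ.2.1, Finset.sum_eq_zero, mul_one, zero_add]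
    · rfl
    · intro k _
      rw [if_neg, mul_zero]
      intro h
      have := ξ.level_eq hT (k + 1)
      rw [h, level_root] at this
      omega
  | succ n ih =>
    have h := flux_end hT hfin hpos hw hX ξ n K
    simp only [mul_sub, Finset.sum_sub_distrib] at h
    rw [Finset.sum_range_succ _ n]
    linarith

end Flux

/-! ### Convergence of paths to the boundary -/

section Paths

variable {I Ω : Type*} {T : SimpleGraph I} {r : I} {Y : ℕ → Ω → Option I} {E : ℕ → Ω → ℝ≥0∞}

/-- The almost sure properties of the paths of the chain. -/
structure RegularPath (T : SimpleGraph I) (r : I) (Y : ℕ → Ω → Option I) (E : ℕ → Ω → ℝ≥0∞)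
    (ω : Ω) : Prop where
  start : Y 0 ω = some r
  step : ∀ n, GoodStep T r (Y n ω) (Y (n + 1) ω)
  escape : ∀ v, ∀ᶠ n in atTop, Y n ω ≠ some v
  time_pos : ∀ n, 0 < E n ω
  time_lt_top : ∀ n, Y n ω ≠ none → E n ω < ∞
  time_eq_top : ∀ n, Y n ω = none → E n ω = ∞

/-- The jump chain converges to the end `ξ`. -/
def ConvergesTo (Y : ℕ → Ω → Option I) (ω : Ω) (ξ : Ends T r) : Prop :=
  ∀ m, ∀ᶠ n in atTop, ω ∈ inBranch T r Y (ξ m) n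

theorem ConvergesTo.eq_of_eventually (hT : T.IsTree) {ω : Ω} {ξ : Ends T r}
    (h : ConvergesTo Y ω ξ) {v : I} (hv : ∀ᶠ n in atTop, ω ∈ inBranch T r Y v n) :
    ξ (level T r v) = v := by
  obtain ⟨n, ⟨j, hj, h1⟩, ⟨j', hj', h2⟩⟩ := ((h (level T r v)).and hv).exists
  obtain rfl : j = j' := by simpa using hj.symm.trans hj'
  exact h1.eq_of_level_eq hT h2 (ξ.level_eq hT _)

theorem RegularPath.none_of_le {ω : Ω} (h : RegularPath T r Y E ω) {m n : ℕ} (hmn : m ≤ n)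
    (hm : Y m ω = none) : Y n ω = none := by
  induction n, hmn using Nat.le_induction with
  | base => exact hm
  | succ n _ ih =>
    rcases h.step n with ⟨i, j, hi, -⟩ | ⟨-, h⟩ | ⟨-, h⟩
    · simp [hi] at ih
    · exact h
    · exact h

theorem RegularPath.level_le (hT : T.IsTree) {ω : Ω} (h : RegularPath T r Y E ω) (n : ℕ) :
    ∀ j, Y n ω = some j → level T r j ≤ n := by
  induction n with
  | zero =>
    intro j hj
    obtain rfl : r = j := by simpa using h.start.symm.trans hj
    exact level_root.le
  | succ n ih =>
    intro j hj
    rcases h.step n with ⟨x, y, hx, hy, hxy⟩ | ⟨-, h⟩ | ⟨-, h⟩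
    · obtain rfl : y = j := by simpa using hy.symm.trans hj
      have := ih x hx
      rcases IsChild.of_adj (r := r) hT hxy with h | h <;> have := h.2 <;> omega
    · simp [h] at hj
    · simp [h] at hj

/-- Finitely many vertices have level at most m, so the path eventually stays at levels at least m.
From then on it cannot leave the branch of its ancestor at level m, since leaving means stepping to
the parent of that ancestor. These ancestors form the limiting end. -/
theorem RegularPath.exists_convergesTo (hT : T.IsTree) (hfin : ∀ i, (T.neighborSet i).Finite)
    (hbranch : ∀ i, {j | Prec T r i j}.Infinite) {ω : Ω} (h : RegularPath T r Y E ω)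
    (hn : ∀ n, Y n ω ≠ none) : ∃ ξ : Ends T r, ConvergesTo Y ω ξ := by
  have hlev : ∀ m, ∀ᶠ n in atTop, ∀ j, Y n ω = some j → m ≤ level T r j := by
    intro m
    have : ∀ᶠ n in atTop, ∀ v ∈ {v | level T r v ≤ m}, Y n ω ≠ some v :=
      (eventually_all_finite (finite_level_le hT hfin m)).2 fun v _ => h.escape v
    filter_upwards [this] with n hn j hj
    by_contra h'
    exact hn j (Set.mem_ofPred.2 (not_le.1 h').le) hj
  have hex : ∀ m, ∃ v, level T r v = m ∧ ∀ᶠ n in atTop, ω ∈ inBranch T r Y v n := by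
    intro m
    obtain ⟨N, hN⟩ := eventually_atTop.1 (hlev m)
    obtain ⟨j, hj⟩ := Option.ne_none_iff_exists'.1 (hn N)
    obtain ⟨η, hη⟩ := Ends.exists_apply_eq hT hbranch j
    refine ⟨η m, η.level_eq hT m, eventually_atTop.2 ⟨N, fun n hn => ?_⟩⟩
    induction n, hn using Nat.le_induction with
    | base =>
      refine ⟨j, hj, ?_⟩
      rw [← hη, η.prec_iff hT]
      exact ⟨m, hN N le_rfl j hj, rfl⟩
    | succ n hNn ih =>
      obtain ⟨x, hx, hxm⟩ := ih
      rcases h.step n with ⟨x', y, hx', hy, hxy⟩ | ⟨-, h'⟩ | ⟨-, h'⟩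
      · obtain rfl : x = x' := by simpa using hx.symm.trans hx'
        refine ⟨y, hy, ?_⟩
        by_contra hc
        obtain ⟨h1, h2⟩ := hxm.eq_of_adj_of_not hT hxy hc
        have h3 := hN (n + 1) (by omega) y hy
        have h4 := h2.2
        rw [← h1, η.level_eq hT] at h4
        omega
      · exact absurd h' (hn _)
      · exact absurd h' (hn _)
  choose s hs hs' using hex
  refine ⟨.ofChild s ((level_eq_zero hT).1 (hs 0)) fun m => ?_, hs'⟩
  obtain ⟨n, ⟨j, hj, h1⟩, ⟨j', hj', h2⟩⟩ := ((hs' m).and (hs' (m + 1))).exists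
  obtain rfl : j = j' := by simpa using hj.symm.trans hj'
  obtain ⟨η, hη⟩ := Ends.exists_apply_eq hT hbranch j
  rw [← hη, η.prec_iff hT] at h1 h2
  obtain ⟨k, -, hk⟩ := h1
  obtain ⟨l, -, hl⟩ := h2
  have hk' := hs m
  have hl' := hs (m + 1)
  rw [hk, η.level_eq hT] at hk'
  rw [hl, η.level_eq hT] at hl'
  rw [hk, hl, hk', hl']
  exact η.isChild hT m

theorem RegularPath.jumpTime_lt_top {ω : Ω} (h : RegularPath T r Y E ω) {n : ℕ}
    (hn : ∀ k < n, Y k ω ≠ none) : jumpTime E n ω < ∞ :=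
  ENNReal.sum_lt_top.2 fun k hk => h.time_lt_top k (hn k (Finset.mem_range.1 hk))

theorem RegularPath.jumpTime_strictMono {ω : Ω} (h : RegularPath T r Y E ω)
    (hn : ∀ n, Y n ω ≠ none) : StrictMono fun n => jumpTime E n ω :=
  strictMono_nat_of_lt_succ fun n => by
    simp only [jumpTime, Finset.sum_range_succ]
    exact ENNReal.lt_add_right (h.jumpTime_lt_top fun k _ => hn k).ne (h.time_pos n).ne'

theorem RegularPath.hittingTime_lt_top {ω : Ω} (h : RegularPath T r Y E ω)
    (hn : ∃ n, Y n ω = none) : hittingTime Y E none ω < ∞ := by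
  classical
  have hlt : jumpTime E (Nat.find hn) ω < ∞ := h.jumpTime_lt_top fun k hk => Nat.find_min hn hk
  refine lt_of_le_of_lt (sInf_le ⟨Nat.find hn, le_rfl, ?_, Nat.find_spec hn⟩) hlt
  rw [show jumpTime E (Nat.find hn + 1) ω = jumpTime E (Nat.find hn) ω + E (Nat.find hn) ω from
    Finset.sum_range_succ _ _, h.time_eq_top _ (Nat.find_spec hn), add_top]
  exact hlt

theorem hittingTime_eq_top {ω : Ω} (hn : ∀ n, Y n ω ≠ none) : hittingTime Y E none ω = ∞ := by
  rw [hittingTime, sInf_eq_top]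
  rintro t ⟨n, -, -, h⟩
  exact absurd h (hn n)

theorem tendsto_jumpTime (ω : Ω) :
    Tendsto (fun n => jumpTime E n ω) atTop (𝓝 (explosionTime E ω)) :=
  ENNReal.tendsto_nat_tsum _

theorem RegularPath.jumpTime_lt_explosionTime {ω : Ω} (h : RegularPath T r Y E ω)
    (hn : ∀ n, Y n ω ≠ none) (n : ℕ) : jumpTime E n ω < explosionTime E ω :=
  (h.jumpTime_strictMono hn (Nat.lt_succ_self n)).trans_le
    ((h.jumpTime_strictMono hn).monotone.ge_of_tendsto (tendsto_jumpTime ω) (n + 1))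

theorem RegularPath.exitsAt_of_convergesTo {ω : Ω} (h : RegularPath T r Y E ω)
    (hn : ∀ n, Y n ω ≠ none) {ξ : Ends T r} (hξ : ConvergesTo Y ω ξ) : ExitsAt Y E ω ξ := by
  classical
  refine ⟨hittingTime_eq_top hn, fun m => ?_⟩
  obtain ⟨N, hN⟩ := eventually_atTop.1 (hξ m)
  filter_upwards [Ioo_mem_nhdsLT (h.jumpTime_lt_explosionTime hn N)] with t ht
  -- The least such n is the index of the last jump up to time t.
  have hex : ∃ n, t < jumpTime E (n + 1) ω := by
    obtain ⟨n, hn'⟩ := ((tendsto_jumpTime (E := E) ω).eventually_const_lt ht.2).exists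
    exact ⟨n, hn'.trans_le ((h.jumpTime_strictMono hn).monotone (Nat.le_succ n))⟩
  have hle : jumpTime E (Nat.find hex) ω ≤ t := by
    rcases hk : Nat.find hex with _ | k
    · simp [jumpTime]
    · exact not_lt.1 (Nat.find_min hex (m := k) (by omega))
  have hge : N ≤ Nat.find hex := by
    by_contra hc
    have h1 := Nat.find_spec hex
    have h2 : jumpTime E (Nat.find hex + 1) ω ≤ jumpTime E N ω :=
      (h.jumpTime_strictMono hn).monotone (by omega)
    exact absurd (h1.trans_le h2) (not_lt.2 ht.1.le)
  obtain ⟨j, hj, hjm⟩ := hN _ hge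
  exact ⟨j, ⟨Nat.find hex, hle, Nat.find_spec hex, hj⟩, hjm⟩

/-- The convergence is tested at the jump times, which increase strictly to the explosion time; at
the n-th one the state is `Y n`. -/
theorem RegularPath.convergesTo_of_exitsAt {ω : Ω} (h : RegularPath T r Y E ω)
    (hn : ∀ n, Y n ω ≠ none) {ξ : Ends T r} (hξ : ExitsAt Y E ω ξ) : ConvergesTo Y ω ξ := by
  intro m
  have ht : Tendsto (fun n => jumpTime E n ω) atTop (𝓝[<] (explosionTime E ω)) :=
    tendsto_nhdsWithin_iff.2 ⟨tendsto_jumpTime ω,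
      .of_forall fun n => h.jumpTime_lt_explosionTime hn n⟩
  filter_upwards [ht.eventually (hξ.2 m)] with n hn'
  obtain ⟨j, ⟨n', h1, h2, h3⟩, hj⟩ := hn'
  have h4 := (h.jumpTime_strictMono hn).le_iff_le.1 h1
  have h5 := (h.jumpTime_strictMono hn).lt_iff_lt.1 h2
  obtain rfl : n' = n := by omega
  exact ⟨j, h3, hj⟩

end Paths

/-! ### The law of the exit point -/

section ExitLaw

variable {I Ω : Type*} [MeasurableSpace Ω] {T : SimpleGraph I} {r : I} {w : ℕ → ℝ}
  {P : Measure Ω} {Y : ℕ → Ω → Option I} {E : ℕ → Ω → ℝ≥0∞}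

/-- The event that the chain never reaches `∂_r`. -/
def survival (Y : ℕ → Ω → Option I) : Set Ω := {ω | ∀ n, Y n ω ≠ none}

theorem measurableSet_survival (hX : IsMinimalChain (generator T r w) (some r) P Y E) :
    MeasurableSet (survival Y) := by
  have : survival Y = ⋂ n, {ω | Y n ω = none}ᶜ := by ext; simp [survival]
  rw [this]
  exact MeasurableSet.iInter fun n => (hX.measurableSet_state n none).compl

variable [Countable I] [IsProbabilityMeasure P]

/-- By `potential_end` the expected number of visits to v is at most w_0 times the rate of v;
Borel-Cantelli concludes. -/
theorem ae_eventually_ne (hT : T.IsTree) (hfin : ∀ i, (T.neighborSet i).Finite)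
    (hbranch : ∀ i, {j | Prec T r i j}.Infinite) (hpos : ∀ n, 0 < w n) (hw : StrictMono w)
    (hX : IsMinimalChain (generator T r w) (some r) P Y E) (v : I) :
    ∀ᵐ ω ∂P, ∀ᶠ n in atTop, Y n ω ≠ some v := by
  obtain ⟨ξ, hξ⟩ := Ends.exists_apply_eq hT hbranch v
  have hr := rate_pos (T := T) (r := r) hpos hw v
  have hb : ∀ n, ∑ l ∈ Finset.range n, P.real {ω | Y l ω = some v} ≤ w 0 * rate T r w v := by
    intro n
    have h := potential_end hT hfin hpos hw hX ξ n (level T r v)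
    have h1 : 0 ≤ ∑ k ∈ Finset.range (level T r v + 1),
        increment w k * P.real (inBranch T r Y (ξ k) n) :=
      Finset.sum_nonneg fun k _ => mul_nonneg (increment_pos hpos hw k).le measureReal_nonneg
    rw [hξ, ← Finset.sum_div] at h
    rw [← div_le_iff₀ hr]
    linarith
  have hs : Summable fun l => P.real {ω | Y l ω = some v} :=
    summable_of_sum_range_le (fun _ => measureReal_nonneg) hb
  refine ae_eventually_notMem (s := fun l => {ω | Y l ω = some v}) ?_
  have : ∀ l, P {ω | Y l ω = some v} = ENNReal.ofReal (P.real {ω | Y l ω = some v}) :=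
    fun l => (ofReal_measureReal).symm
  simp only [this]
  exact hs.tsum_ofReal_ne_top

theorem ae_regularPath (hT : T.IsTree) (hfin : ∀ i, (T.neighborSet i).Finite)
    (hbranch : ∀ i, {j | Prec T r i j}.Infinite) (hpos : ∀ n, 0 < w n) (hw : StrictMono w)
    (hX : IsMinimalChain (generator T r w) (some r) P Y E) :
    ∀ᵐ ω ∂P, RegularPath T r Y E ω := by
  have hj := jumpProb_nonneg (T := T) (r := r) hpos hw
  have hrow := tsum_jumpProb (r := r) hT hfin hpos hw
  filter_upwards [hX.start, ae_goodStep hT hfin hpos hw hX,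
    ae_all_iff.2 (ae_eventually_ne hT hfin hbranch hpos hw hX), ae_time_pos hX hj hrow,
    ae_time_lt_top hX hj hrow, ae_time_eq_top hX hj hrow (a := none) rfl] with ω h1 h2 h3 h4 h5 h6
  refine ⟨h1, h2, h3, h4, fun n hn => h5 n ?_, h6⟩
  obtain ⟨i, hi⟩ := Option.ne_none_iff_exists'.1 hn
  rw [hi, generator_self]
  exact neg_lt_zero.2 (rate_pos hpos hw i)

theorem measure_survival_pos (hT : T.IsTree) (hfin : ∀ i, (T.neighborSet i).Finite)
    (hbranch : ∀ i, {j | Prec T r i j}.Infinite) (hpos : ∀ n, 0 < w n) (hw : StrictMono w)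
    (hX : IsMinimalChain (generator T r w) (some r) P Y E)
    (htransient : P {ω | hittingTime Y E none ω < ∞} < 1) : 0 < P (survival Y) := by
  refine pos_iff_ne_zero.2 fun h0 => htransient.not_ge ?_
  rw [← measure_univ (μ := P)]
  refine measure_mono_ae ?_
  filter_upwards [ae_regularPath hT hfin hbranch hpos hw hX, measure_eq_zero_iff_ae_notMem.1 h0]
    with ω h h' _
  exact h.hittingTime_lt_top (by simpa [survival] using h')

/-- The point chosen by `Classical.epsilon` has no evident measurability. On survival, off a
measurable null set, it is the limit of the path; making it constant elsewhere yields a measurable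
map with the same conditional law. -/
theorem exists_exit_point (hT : T.IsTree) (hfin : ∀ i, (T.neighborSet i).Finite)
    (hbranch : ∀ i, {j | Prec T r i j}.Infinite) (hpos : ∀ n, 0 < w n) (hw : StrictMono w)
    (hX : IsMinimalChain (generator T r w) (some r) P Y E) :
    ∃ X : Ω → Ends T r, Measurable X ∧ (∀ᵐ ω ∂P, ω ∈ survival Y → ConvergesTo Y ω (X ω)) ∧
      exitMeasure T r P Y E = (P[|survival Y]).map X := by
  classical
  obtain ⟨ξ₀, -⟩ := Ends.exists_apply_eq hT hbranch r
  have hne : Nonempty (Ends T r) := ⟨ξ₀⟩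
  have hreg := ae_regularPath hT hfin hbranch hpos hw hX
  obtain ⟨N, hN, hNm, hN0⟩ := exists_measurable_superset_of_null hreg
  have hgood : ∀ ω ∉ N, RegularPath T r Y E ω := fun ω hω => by
    by_contra h; exact hω (hN h)
  let A := survival Y \ N
  have hA : MeasurableSet A := (measurableSet_survival hX).diff hNm
  let ε : Ω → Ends T r := fun ω => Classical.epsilon fun ξ => ExitsAt Y E ω ξ
  have hε : ∀ ω ∈ A, ConvergesTo Y ω (ε ω) := by
    rintro ω ⟨hs, hω⟩
    obtain ⟨ξ, hξ⟩ := (hgood ω hω).exists_convergesTo hT hfin hbranch hs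
    exact (hgood ω hω).convergesTo_of_exitsAt hs
      (Classical.epsilon_spec (p := fun ξ => ExitsAt Y E ω ξ)
        ⟨ξ, (hgood ω hω).exitsAt_of_convergesTo hs hξ⟩)
  have hNae : ∀ᵐ ω ∂P, ω ∉ N := measure_eq_zero_iff_ae_notMem.1 hN0
  let X : Ω → Ends T r := fun ω => if ω ∈ A then ε ω else ξ₀
  have hX_meas : Measurable X := by
    refine measurable_generateFrom ?_
    rintro _ ⟨v, rfl⟩
    -- On A, the limit lies in the cylinder of v exactly when the path is eventually in the branch
    -- of v.
    have : X ⁻¹' cylinder T r v =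
        (A ∩ {ω | ∀ᶠ n in atTop, ω ∈ inBranch T r Y v n}) ∪
          (Aᶜ ∩ {_ω | ξ₀ ∈ cylinder T r v}) := by
      ext ω
      by_cases hω : ω ∈ A
      · simp only [X, Set.mem_preimage, hω, if_true, Set.mem_union, Set.mem_inter_iff, true_and,
          Set.mem_compl_iff, not_true, false_and, or_false, mem_cylinder_iff hT, Set.mem_ofPred_eq]
        refine ⟨fun h => ?_, (hε ω hω).eq_of_eventually hT⟩
        have := hε ω hω (level T r v)
        rwa [h] at this
      · simp [X, hω]
    rw [this]
    refine (hA.inter ?_).union (hA.compl.inter (.const _))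
    have : {ω | ∀ᶠ n in atTop, ω ∈ inBranch T r Y v n} =
        ⋃ N, ⋂ n, ⋂ (_ : N ≤ n), inBranch T r Y v n := by
      ext ω; simp [eventually_atTop]
    rw [this]
    exact MeasurableSet.iUnion fun N => MeasurableSet.iInter fun n => MeasurableSet.iInter
      fun _ => measurableSet_inBranch hX v n
  refine ⟨X, hX_meas, ?_, ?_⟩
  · filter_upwards [hNae] with ω hω hs
    have hωA : ω ∈ A := ⟨hs, hω⟩
    simp only [X, hωA, if_true]
    exact hε ω hωA
  · have hS : {ω | ∃ ξ : Ends T r, ExitsAt Y E ω ξ} =ᵐ[P] survival Y := by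
      filter_upwards [hreg] with ω h
      refine propext ⟨?_, fun hs => ?_⟩
      · rintro ⟨ξ, hξ⟩
        by_contra hc
        have hc' : ¬ ∀ n, Y n ω ≠ none := hc
        push Not at hc'
        exact (h.hittingTime_lt_top hc').ne hξ.1
      · obtain ⟨ξ, hξ⟩ := h.exists_convergesTo hT hfin hbranch hs
        exact ⟨ξ, h.exitsAt_of_convergesTo hs hξ⟩
    have hcond : P[|{ω | ∃ ξ : Ends T r, ExitsAt Y E ω ξ}] = P[|survival Y] := by
      simp only [ProbabilityTheory.cond]
      rw [measure_congr hS, Measure.restrict_congr_set hS]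
    rw [exitMeasure, dif_pos hne, hcond]
    refine Measure.map_congr ?_
    have h1 : ∀ᵐ ω ∂P[|survival Y], ω ∈ survival Y := ae_cond_mem (measurableSet_survival hX)
    have h2 : ∀ᵐ ω ∂P[|survival Y], ω ∉ N := cond_absolutelyContinuous.ae_le hNae
    filter_upwards [h1, h2] with ω hs hω
    have hωA : ω ∈ A := ⟨hs, hω⟩
    simp only [X, hωA, if_true, ε]

end ExitLaw

/-! ### The exit measure is the equilibrium measure -/

section Equilibrium

variable {I : Type*} {T : SimpleGraph I} {r : I} {w : ℕ → ℝ}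

/-- The vertices of level at most n on the geodesic of η are η(0), …, η(n). After integration,
energies, which are sums over vertices, become integrals of potentials. -/
theorem sum_indicator_cylinder (hT : T.IsTree) (hfin : ∀ i, (T.neighborSet i).Finite) (n : ℕ)
    (g : I → ℝ) (η : Ends T r) :
    ∑ v ∈ (finite_level_le (r := r) hT hfin n).toFinset, (cylinder T r v).indicator (fun _ => g v) η =
      ∑ k ∈ Finset.range (n + 1), g (η k) := by
  classical
  rw [← Finset.sum_image (s := Finset.range (n + 1)) (g := fun k => η k) (f := g)
    fun a _ b _ h => η.2.2.2 h]
  simp only [Set.indicator_apply]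
  rw [← Finset.sum_filter]
  refine Finset.sum_congr ?_ fun _ _ => rfl
  ext v
  simp only [Finset.mem_filter, Set.Finite.mem_toFinset, Set.mem_ofPred_eq, mem_cylinder_iff hT,
    Finset.mem_image, Finset.mem_range]
  constructor
  · rintro ⟨h1, h2⟩
    exact ⟨_, Nat.lt_succ_of_le h1, h2⟩
  · rintro ⟨k, hk, rfl⟩
    rw [η.level_eq hT]
    exact ⟨Nat.le_of_lt_succ hk, rfl⟩

theorem sum_mul_real_cylinder (hT : T.IsTree) (hfin : ∀ i, (T.neighborSet i).Finite)
    {μ : Measure (Ends T r)} [IsFiniteMeasure μ] (n : ℕ) (g : I → ℝ) :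
    ∑ v ∈ (finite_level_le (r := r) hT hfin n).toFinset, g v * μ.real (cylinder T r v) =
      ∫ η, ∑ k ∈ Finset.range (n + 1), g (η k) ∂μ := by
  simp_rw [← sum_indicator_cylinder hT hfin]
  rw [integral_finsetSum _ fun v _ =>
    (integrable_const (g v)).indicator (measurableSet_cylinder v)]
  refine Finset.sum_congr rfl fun v _ => ?_
  rw [integral_indicator_const _ (measurableSet_cylinder v), smul_eq_mul, mul_comm]

theorem integrable_sum_apply (hT : T.IsTree) (hfin : ∀ i, (T.neighborSet i).Finite)
    {μ : Measure (Ends T r)} [IsFiniteMeasure μ] (n : ℕ) (g : I → ℝ) :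
    Integrable (fun η : Ends T r => ∑ k ∈ Finset.range (n + 1), g (η k)) μ := by
  simp_rw [← sum_indicator_cylinder hT hfin]
  exact integrable_finsetSum _ fun v _ =>
    (integrable_const (g v)).indicator (measurableSet_cylinder v)

variable {Ω : Type*} [MeasurableSpace Ω] {P : Measure Ω} {Y : ℕ → Ω → Option I}
  {E : ℕ → Ω → ℝ≥0∞} [Countable I] [IsProbabilityMeasure P]

/-- The indicators converge almost surely: a surviving path is eventually inside or eventually
outside the branch, according to its limit, and an absorbed one is eventually outside. -/
theorem tendsto_real_inBranch (hT : T.IsTree) (hfin : ∀ i, (T.neighborSet i).Finite)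
    (hbranch : ∀ i, {j | Prec T r i j}.Infinite) (hpos : ∀ n, 0 < w n) (hw : StrictMono w)
    (hX : IsMinimalChain (generator T r w) (some r) P Y E) {X : Ω → Ends T r} (hXm : Measurable X)
    (hXc : ∀ᵐ ω ∂P, ω ∈ survival Y → ConvergesTo Y ω (X ω)) (v : I) :
    Tendsto (fun n => P.real (inBranch T r Y v n)) atTop
      (𝓝 (P.real (survival Y) * ((P[|survival Y]).map X).real (cylinder T r v))) := by
  have hS := measurableSet_survival hX
  have h1 : P.real (survival Y) * ((P[|survival Y]).map X).real (cylinder T r v) =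
      P.real (survival Y ∩ X ⁻¹' cylinder T r v) := by
    rw [measureReal_def ((P[|survival Y]).map X), Measure.map_apply hXm (measurableSet_cylinder v),
      measureReal_def, measureReal_def, ← ENNReal.toReal_mul, mul_comm, cond_mul_eq_inter hS]
  rw [h1]
  refine (ENNReal.tendsto_toReal (measure_ne_top _ _)).comp
    (tendsto_measure_of_ae_tendsto_indicator_of_isFiniteMeasure _
      (hS.inter (hXm (measurableSet_cylinder v))) (fun n => measurableSet_inBranch hX v n) ?_)
  filter_upwards [hXc, ae_regularPath hT hfin hbranch hpos hw hX] with ω hω hreg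
  by_cases hs : ω ∈ survival Y
  · have hc := hω hs
    simp only [Set.mem_inter_iff, hs, true_and, Set.mem_preimage, mem_cylinder_iff hT]
    by_cases hv : (X ω) (level T r v) = v
    · have := hc (level T r v)
      rw [hv] at this
      filter_upwards [this] with n hn
      exact ⟨fun _ => hv, fun _ => hn⟩
    · filter_upwards [hc (level T r v)] with n hn
      refine ⟨fun h => absurd ?_ hv, fun h => absurd h hv⟩
      obtain ⟨j, hj, h1⟩ := hn
      obtain ⟨j', hj', h2⟩ := h
      obtain rfl : j = j' := by simpa using hj.symm.trans hj'
      exact h1.eq_of_level_eq hT h2 ((X ω).level_eq hT _)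
  · have hs' : ¬ ∀ n, Y n ω ≠ none := hs
    push Not at hs'
    obtain ⟨N, hN⟩ := hs'
    filter_upwards [eventually_ge_atTop N] with n hn
    refine ⟨?_, fun h => absurd h.1 hs⟩
    rintro ⟨j, hj, -⟩
    rw [hreg.none_of_le hn hN] at hj
    exact absurd hj (by simp)

theorem potential_end_le (hT : T.IsTree) (hfin : ∀ i, (T.neighborSet i).Finite)
    (hpos : ∀ n, 0 < w n) (hw : StrictMono w)
    (hX : IsMinimalChain (generator T r w) (some r) P Y E) (ξ : Ends T r) (n K : ℕ) :
    ∑ k ∈ Finset.range (K + 1), increment w k * P.real (inBranch T r Y (ξ k) n) ≤ w 0 := by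
  have h1 := potential_end hT hfin hpos hw hX ξ n K
  have h2 : 0 ≤ ∑ l ∈ Finset.range n, P.real {ω | Y l ω = some (ξ K)} / rate T r w (ξ K) :=
    Finset.sum_nonneg fun l _ => div_nonneg measureReal_nonneg (rate_pos hpos hw _).le
  linarith

/-- Fewer than n jumps cannot reach level n, so the Green term of `potential_end` vanishes for K =
n. -/
theorem potential_end_eq (hT : T.IsTree) (hfin : ∀ i, (T.neighborSet i).Finite)
    (hbranch : ∀ i, {j | Prec T r i j}.Infinite) (hpos : ∀ n, 0 < w n) (hw : StrictMono w)
    (hX : IsMinimalChain (generator T r w) (some r) P Y E) (ξ : Ends T r) (n : ℕ) :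
    ∑ k ∈ Finset.range (n + 1), increment w k * P.real (inBranch T r Y (ξ k) n) = w 0 := by
  have h1 := potential_end hT hfin hpos hw hX ξ n n
  rw [Finset.sum_eq_zero (s := Finset.range n), add_zero] at h1
  · exact h1
  · intro l hl
    have : P {ω | Y l ω = some (ξ n)} = 0 := by
      refine measure_eq_zero_iff_ae_notMem.2 ?_
      filter_upwards [ae_regularPath hT hfin hbranch hpos hw hX] with ω hω h
      have := hω.level_le hT l _ h
      rw [ξ.level_eq hT] at this
      exact absurd (Finset.mem_range.1 hl) (not_lt.2 this)
    rw [measureReal_def, this, ENNReal.toReal_zero, zero_div]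

/-- The energy is the mean of ∑ Δ_{|v|}(w) p_n(v) over the vertices v ≼ Y_n of level at most n.
While the chain is alive, this sum is at most the truncated potential along an end through Y_n,
hence at most w_0. -/
theorem energy_inBranch_le (hT : T.IsTree) (hfin : ∀ i, (T.neighborSet i).Finite)
    (hbranch : ∀ i, {j | Prec T r i j}.Infinite) (hpos : ∀ n, 0 < w n) (hw : StrictMono w)
    (hX : IsMinimalChain (generator T r w) (some r) P Y E) (n : ℕ) :
    ∑ v ∈ (finite_level_le (r := r) hT hfin n).toFinset,
      increment w (level T r v) * P.real (inBranch T r Y v n) ^ 2 ≤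
        w 0 * P.real (inBranch T r Y r n) := by
  set F := (finite_level_le (r := r) hT hfin n).toFinset
  set g : I → ℝ := fun v => increment w (level T r v) * P.real (inBranch T r Y v n) with hg
  have hg0 : ∀ v, 0 ≤ g v := fun v => mul_nonneg (increment_pos hpos hw _).le measureReal_nonneg
  have hi : ∀ v, Integrable ((inBranch T r Y v n).indicator fun _ => g v) P := fun v =>
    (integrable_const (g v)).indicator (measurableSet_inBranch hX v n)
  calc ∑ v ∈ F, increment w (level T r v) * P.real (inBranch T r Y v n) ^ 2
      = ∫ ω, ∑ v ∈ F, (inBranch T r Y v n).indicator (fun _ => g v) ω ∂P := by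
        rw [integral_finsetSum _ fun v _ => hi v]
        refine Finset.sum_congr rfl fun v _ => ?_
        rw [integral_indicator_const _ (measurableSet_inBranch hX v n), smul_eq_mul]
        ring
    _ ≤ ∫ ω, (inBranch T r Y r n).indicator (fun _ => w 0) ω ∂P := by
        refine integral_mono (integrable_finsetSum _ fun v _ => hi v)
          ((integrable_const _).indicator (measurableSet_inBranch hX r n)) fun ω => ?_
        by_cases hω : ω ∈ inBranch T r Y r n
        · rw [Set.indicator_of_mem hω]
          obtain ⟨j, hj, -⟩ := hω
          obtain ⟨η, hη⟩ := Ends.exists_apply_eq hT hbranch j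
          refine le_trans (Finset.sum_le_sum fun v _ => ?_)
            ((sum_indicator_cylinder hT hfin n g η).trans_le ?_)
          · by_cases hv : ω ∈ inBranch T r Y v n
            · obtain ⟨j', hj', h⟩ := hv
              obtain rfl : j = j' := by simpa using hj.symm.trans hj'
              rw [← hη, η.prec_iff hT] at h
              obtain ⟨k, hkl, hk⟩ := h
              rw [Set.indicator_of_mem (show ω ∈ inBranch T r Y v n from ⟨j, hj, by
                rw [← hη, η.prec_iff hT]; exact ⟨k, hkl, hk⟩⟩),
                Set.indicator_of_mem (show η ∈ cylinder T r v from ⟨k, hk.symm⟩)]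
            · rw [Set.indicator_of_notMem hv]
              exact Set.indicator_nonneg (fun _ _ => hg0 v) _
          · have := potential_end_le hT hfin hpos hw hX η n n
            refine (Finset.sum_congr rfl fun k _ => ?_).trans_le this
            simp only [hg, η.level_eq hT]
        · rw [Set.indicator_of_notMem hω, Finset.sum_eq_zero]
          intro v _
          refine Set.indicator_of_notMem (fun h => hω ?_) _
          obtain ⟨j, hj, -⟩ := h
          exact ⟨j, hj, root_prec hT j⟩
    _ = w 0 * P.real (inBranch T r Y r n) := by
        rw [integral_indicator_const _ (measurableSet_inBranch hX r n), smul_eq_mul, mul_comm]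

theorem exitMeasure_equilibrium (hT : T.IsTree) (hfin : ∀ i, (T.neighborSet i).Finite)
    (hbranch : ∀ i, {j | Prec T r i j}.Infinite) (hpos : ∀ n, 0 < w n) (hw : StrictMono w)
    (hX : IsMinimalChain (generator T r w) (some r) P Y E)
    (htransient : P {ω | hittingTime Y E none ω < ∞} < 1) :
    IsProbabilityMeasure (exitMeasure T r P Y E) ∧ ∃ M : ℝ,
      (∀ (η : Ends T r) (K : ℕ), ∑ k ∈ Finset.range K,
        increment w k * (exitMeasure T r P Y E).real (levelSet k η) ≤ M) ∧
      ∀ᵐ η ∂exitMeasure T r P Y E,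
        HasSum (fun k => increment w k * (exitMeasure T r P Y E).real (levelSet k η)) M := by
  obtain ⟨X, hXm, hXc, hμ⟩ := exists_exit_point hT hfin hbranch hpos hw hX
  have hpos' := measure_survival_pos hT hfin hbranch hpos hw hX htransient
  have hlim := tendsto_real_inBranch hT hfin hbranch hpos hw hX hXm hXc
  rw [← hμ] at hlim
  have hprob : IsProbabilityMeasure (exitMeasure T r P Y E) := by
    rw [hμ]
    have := cond_isProbabilityMeasure hpos'.ne'
    exact Measure.isProbabilityMeasure_map hXm.aemeasurable
  set μ := exitMeasure T r P Y E
  set c := P.real (survival Y) with hc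
  have hc0 : 0 < c := ENNReal.toReal_pos hpos'.ne' (measure_ne_top _ _)
  have hterm : ∀ (η : Ends T r) k, 0 ≤ increment w k * μ.real (levelSet k η) := fun η k =>
    mul_nonneg (increment_pos hpos hw k).le measureReal_nonneg
  -- This is the limit n → ∞ of `potential_end_le`, the branch probabilities tending to c μ(C^k(η)).
  have hle : ∀ (η : Ends T r) (K : ℕ), ∑ k ∈ Finset.range (K + 1),
      increment w k * μ.real (levelSet k η) ≤ w 0 / c := by
    intro η K
    rw [le_div_iff₀ hc0]
    refine le_of_tendsto' (x := atTop) (f := fun n => ∑ k ∈ Finset.range (K + 1),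
      increment w k * P.real (inBranch T r Y (η k) n)) ?_
      fun n => potential_end_le hT hfin hpos hw hX η n K
    rw [Finset.sum_mul]
    refine tendsto_finsetSum _ fun k _ => ?_
    have := (hlim (η k)).const_mul (increment w k)
    convert this using 2
    rw [levelSet]; ring
  refine ⟨hprob, w 0 / c, fun η K => ?_, ?_⟩
  · exact (Finset.sum_le_sum_of_subset_of_nonneg (Finset.range_subset_range.2 (Nat.le_succ K))
      fun k _ _ => hterm η k).trans (hle η K)
  set Ψ : ℕ → Ends T r → ℝ := fun n η => ∑ k ∈ Finset.range (n + 1),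
    increment w k * μ.real (levelSet k η) with hΨ
  let g : I → ℝ := fun v => increment w (level T r v) * μ.real (cylinder T r v)
  have hΨg : ∀ n, Ψ n = fun η : Ends T r => ∑ k ∈ Finset.range (n + 1), g (η k) := by
    intro n
    funext η
    simp only [hΨ, levelSet, Ends.level_eq hT, g]
  have hΨi : ∀ n, Integrable (Ψ n) μ := fun n => by
    rw [hΨg]
    exact integrable_sum_apply hT hfin n g
  -- Cauchy-Schwarz for the energies
  have hCS : ∀ n, w 0 ≤ P.real (inBranch T r Y r n) * ∫ η, Ψ n η ∂μ := by
    intro n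
    set F := (finite_level_le (r := r) hT hfin n).toFinset
    -- The mutual energy of p_n and μ up to level n: the truncated potential of p_n is w_0 on every
    -- end, and μ has mass one.
    have h1 : ∑ v ∈ F, increment w (level T r v) * P.real (inBranch T r Y v n) *
        μ.real (cylinder T r v) = w 0 := by
      rw [sum_mul_real_cylinder hT hfin n
        (fun v => increment w (level T r v) * P.real (inBranch T r Y v n))]
      simp only [Ends.level_eq hT, potential_end_eq hT hfin hbranch hpos hw hX]
      simp
    have h2 : ∑ v ∈ F, increment w (level T r v) * μ.real (cylinder T r v) ^ 2 =
        ∫ η, Ψ n η ∂μ := by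
      rw [hΨg, ← sum_mul_real_cylinder hT hfin n g]
      exact Finset.sum_congr rfl fun v _ => by ring
    have h3 := energy_inBranch_le hT hfin hbranch hpos hw hX n
    have hΔ : ∀ v, 0 ≤ increment w (level T r v) := fun v => (increment_pos hpos hw _).le
    have h4 := Finset.sum_mul_sq_le_sq_mul_sq F
      (fun v => √(increment w (level T r v)) * P.real (inBranch T r Y v n))
      (fun v => √(increment w (level T r v)) * μ.real (cylinder T r v))
    have h5 : ∀ v, √(increment w (level T r v)) * P.real (inBranch T r Y v n) *
        (√(increment w (level T r v)) * μ.real (cylinder T r v)) =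
        increment w (level T r v) * P.real (inBranch T r Y v n) * μ.real (cylinder T r v) := by
      intro v
      rw [mul_mul_mul_comm, Real.mul_self_sqrt (hΔ v)]; ring
    simp only [h5, mul_pow, Real.sq_sqrt (hΔ _), h1, h2] at h4
    have h6 : 0 ≤ ∫ η, Ψ n η ∂μ :=
      integral_nonneg fun η => Finset.sum_nonneg fun k _ => hterm η k
    have h7 := h4.trans (mul_le_mul_of_nonneg_right h3 h6)
    have := hpos 0
    nlinarith
  have hsum : ∀ η, Summable fun k => increment w k * μ.real (levelSet k η) := fun η =>
    summable_of_sum_range_le (hterm η) fun n =>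
      (Finset.sum_le_sum_of_subset_of_nonneg (Finset.range_subset_range.2 (Nat.le_succ n))
        fun k _ _ => hterm η k).trans (hle η n)
  set Φ : Ends T r → ℝ := fun η => ∑' k, increment w k * μ.real (levelSet k η) with hΦ
  have hΨΦ : ∀ η, Tendsto (fun n => Ψ n η) atTop (𝓝 (Φ η)) := fun η =>
    (hsum η).hasSum.tendsto_sum_nat.comp (tendsto_add_atTop_nat 1)
  have hΦle : ∀ η, Φ η ≤ w 0 / c := fun η => le_of_tendsto' (hΨΦ η) fun n => hle η n
  have hΦi : Tendsto (fun n => ∫ η, Ψ n η ∂μ) atTop (𝓝 (∫ η, Φ η ∂μ)) := by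
    refine tendsto_integral_of_dominated_convergence (fun _ => w 0 / c)
      (fun n => (hΨi n).aestronglyMeasurable) (integrable_const _) (fun n => .of_forall fun η => ?_)
      (.of_forall hΨΦ)
    rw [Real.norm_eq_abs, abs_of_nonneg (Finset.sum_nonneg fun k _ => hterm η k)]
    exact hle η n
  have hroot : μ.real (cylinder T r r) = 1 := by
    have : cylinder T r r = Set.univ := Set.eq_univ_of_forall fun η => ⟨0, η.2.1⟩
    rw [this]; simp
  -- Together with Φ ≤ w_0 / c, this bound on the mean forces equality almost everywhere.
  have hge : w 0 ≤ c * ∫ η, Φ η ∂μ := by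
    have h := hlim r
    rw [hroot, mul_one] at h
    exact ge_of_tendsto' (h.mul hΦi) hCS
  have hΦint : Integrable Φ μ := by
    refine Integrable.of_bound (C := w 0 / c) ?_ (.of_forall fun η => ?_)
    · exact aestronglyMeasurable_of_tendsto_ae atTop (fun n => (hΨi n).aestronglyMeasurable)
        (.of_forall hΨΦ)
    · rw [Real.norm_eq_abs, abs_of_nonneg (tsum_nonneg (hterm η))]
      exact hΦle η
  have hzero : ∫ η, (w 0 / c - Φ η) ∂μ = 0 := by
    refine le_antisymm ?_ (integral_nonneg fun η => sub_nonneg.2 (hΦle η))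
    rw [integral_sub (integrable_const _) hΦint, integral_const, probReal_univ, one_smul,
      sub_nonpos, div_le_iff₀ hc0, mul_comm]
    exact hge
  have hae := (integral_eq_zero_iff_of_nonneg (fun η => sub_nonneg.2 (hΦle η))
    ((integrable_const _).sub hΦint)).1 hzero
  filter_upwards [hae] with η hη
  have : Φ η = w 0 / c := by
    have : w 0 / c - Φ η = 0 := hη
    linarith
  rw [← this]
  exact (hsum η).hasSum

end Equilibrium

/-! ### Martingale transforms with a bounded predictable process -/

section Transform

theorem summable_of_pairwise_inner_eq_zero {H : Type*} [NormedAddCommGroup H]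
    [InnerProductSpace ℝ H] [CompleteSpace H] {x : ℕ → H}
    (hx : Pairwise fun i j => inner ℝ (x i) (x j) = 0) (hs : Summable fun i => ‖x i‖ ^ 2) :
    Summable x := by
  have hV : OrthogonalFamily ℝ (fun n => (Submodule.span ℝ {x n} : Submodule ℝ H))
      fun n => (Submodule.span ℝ {x n}).subtypeₗᵢ := by
    intro i j hij v v'
    obtain ⟨a, ha⟩ := Submodule.mem_span_singleton.1 v.2
    obtain ⟨b, hb⟩ := Submodule.mem_span_singleton.1 v'.2
    change inner ℝ (v : H) (v' : H) = 0
    rw [← ha, ← hb, inner_smul_left, inner_smul_right, hx hij, mul_zero, mul_zero]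
  exact (hV.summable_iff_norm_sq_summable
    fun n => ⟨x n, Submodule.mem_span_singleton_self (x n)⟩).2 hs

variable {X : Type*} {m₀ : MeasurableSpace X} {μ : Measure X}

theorem memLp_bdd_mul {g f : X → ℝ} {M : ℝ} (hg : AEStronglyMeasurable g μ) (hM : ∀ x, |g x| ≤ M)
    (hf : MemLp f 2 μ) : MemLp (fun x => g x * f x) 2 μ :=
  hf.of_le_mul (hg.mul hf.1) (.of_forall fun x => by
    rw [norm_mul]; exact mul_le_mul_of_nonneg_right (hM x) (norm_nonneg _))

theorem integrable_mul_of_memLp {f g : X → ℝ} (hf : MemLp f 2 μ) (hg : MemLp g 2 μ) :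
    Integrable (fun x => f x * g x) μ := hf.integrable_mul hg

theorem inner_toLp_eq {f g : X → ℝ} (hf : MemLp f 2 μ) (hg : MemLp g 2 μ) :
    inner ℝ (hf.toLp f) (hg.toLp g) = ∫ x, f x * g x ∂μ := by
  rw [L2.inner_def]
  refine integral_congr_ae ?_
  filter_upwards [hf.coeFn_toLp, hg.coeFn_toLp] with x h1 h2
  rw [h1, h2]
  simp [mul_comm]

theorem integral_mul_condExp [IsProbabilityMeasure μ] {m : MeasurableSpace X} (hm : m ≤ m₀) {φ f : X → ℝ}
    (hφ : MemLp φ 2 μ) (hφm : StronglyMeasurable[m] φ) (hf : MemLp f 2 μ) :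
    ∫ x, φ x * (μ[f | m]) x ∂μ = ∫ x, φ x * f x ∂μ := by
  have h := condExp_mul_of_stronglyMeasurable_left hφm (hφ.integrable_mul hf)
    (hf.integrable (by norm_num))
  exact (integral_congr_ae h).symm.trans (integral_condExp hm)

variable {F : Filtration ℕ m₀} {G : ℕ → X → ℝ} {M : ℝ} {f g : X → ℝ}

theorem memLp_condExpIncrement (hf : MemLp f 2 μ) (n : ℕ) :
    MemLp (condExpIncrement μ F f n) 2 μ := by
  cases n with
  | zero => exact hf.condExp (by norm_num)
  | succ n => exact (hf.condExp (by norm_num)).sub (hf.condExp (by norm_num))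

theorem stronglyMeasurable_condExpIncrement (n : ℕ) :
    StronglyMeasurable[F n] (condExpIncrement μ F f n) := by
  cases n with
  | zero => exact stronglyMeasurable_condExp
  | succ n =>
    exact stronglyMeasurable_condExp.sub (stronglyMeasurable_condExp.mono (F.mono (Nat.le_succ n)))

theorem condExpIncrement_congr {f' : X → ℝ} (h : f =ᵐ[μ] f') (n : ℕ) :
    condExpIncrement μ F f n =ᵐ[μ] condExpIncrement μ F f' n := by
  cases n with
  | zero => exact condExp_congr_ae h
  | succ n => exact (condExp_congr_ae h).sub (condExp_congr_ae h)

theorem condExpIncrement_add (hf : Integrable f μ) (hg : Integrable g μ) (n : ℕ) :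
    condExpIncrement μ F (f + g) n =ᵐ[μ] condExpIncrement μ F f n + condExpIncrement μ F g n := by
  cases n with
  | zero => exact condExp_add hf hg _
  | succ n =>
    filter_upwards [condExp_add hf hg (F n), condExp_add hf hg (F (n + 1))] with x h1 h2
    simp only [condExpIncrement, Pi.sub_apply, Pi.add_apply] at *
    rw [h1, h2]; ring

theorem condExpIncrement_smul (c : ℝ) (n : ℕ) :
    condExpIncrement μ F (c • f) n =ᵐ[μ] c • condExpIncrement μ F f n := by
  cases n with
  | zero => exact condExp_smul c f _
  | succ n =>
    filter_upwards [condExp_smul c f (F n), condExp_smul (μ := μ) c f (F (n + 1))] with x h1 h2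
    simp only [condExpIncrement, Pi.sub_apply, Pi.smul_apply, smul_eq_mul] at *
    rw [h1, h2]; ring

theorem sum_condExpIncrement (N : ℕ) (x : X) :
    ∑ n ∈ Finset.range (N + 1), condExpIncrement μ F f n x = (μ[f | F N]) x := by
  induction N with
  | zero => simp [condExpIncrement]
  | succ N ih => rw [Finset.sum_range_succ, ih]; simp [condExpIncrement]

/-- A predictable process bounded by `M`. -/
structure BoundedPredictable (F : Filtration ℕ m₀) (G : ℕ → X → ℝ) (M : ℝ) : Prop where
  zero : StronglyMeasurable[F 0] (G 0)
  succ : ∀ n, StronglyMeasurable[F n] (G (n + 1))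
  bound : ∀ n x, |G n x| ≤ M

theorem BoundedPredictable.adapted (hG : BoundedPredictable F G M) (n : ℕ) :
    StronglyMeasurable[F n] (G n) := by
  cases n with
  | zero => exact hG.zero
  | succ n => exact (hG.succ n).mono (F.mono (Nat.le_succ n))

theorem memLp_transform (hG : BoundedPredictable F G M) (hf : MemLp f 2 μ) (n : ℕ) :
    MemLp (fun x => G n x * condExpIncrement μ F f n x) 2 μ :=
  memLp_bdd_mul ((hG.adapted n).mono (F.le n)).aestronglyMeasurable (hG.bound n)
    (memLp_condExpIncrement hf n)

variable [IsProbabilityMeasure μ]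

/-- Increments are orthogonal to the past. -/
theorem integral_mul_condExpIncrement_succ {φ : X → ℝ} {n : ℕ} (hφ : MemLp φ 2 μ)
    (hφm : StronglyMeasurable[F n] φ) (hf : MemLp f 2 μ) :
    ∫ x, φ x * condExpIncrement μ F f (n + 1) x ∂μ = 0 := by
  simp only [condExpIncrement, Pi.sub_apply, mul_sub]
  rw [integral_sub (integrable_mul_of_memLp hφ (hf.condExp (by norm_num)))
    (integrable_mul_of_memLp hφ (hf.condExp (by norm_num))),
    integral_mul_condExp (F.le _) hφ hφm hf,
    integral_mul_condExp (F.le _) hφ (hφm.mono (F.mono (Nat.le_succ n))) hf, sub_self]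

/-- The increment is the image of f under an orthogonal projection. -/
theorem integral_condExpIncrement_sq (hf : MemLp f 2 μ) (n : ℕ) :
    ∫ x, condExpIncrement μ F f n x ^ 2 ∂μ = ∫ x, condExpIncrement μ F f n x * f x ∂μ := by
  have hd := memLp_condExpIncrement (F := F) hf n
  have hdm := stronglyMeasurable_condExpIncrement (μ := μ) (F := F) (f := f) n
  rw [← integral_mul_condExp (F.le n) hd hdm hf]
  cases n with
  | zero => simp only [condExpIncrement, pow_two]
  | succ n =>
    have h : ∀ x, condExpIncrement μ F f (n + 1) x ^ 2 =
        condExpIncrement μ F f (n + 1) x * (μ[f | F (n + 1)]) x -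
          (μ[f | F n]) x * condExpIncrement μ F f (n + 1) x := by
      intro x; simp only [condExpIncrement, Pi.sub_apply]; ring
    simp only [h]
    rw [integral_sub (integrable_mul_of_memLp hd (hf.condExp (by norm_num)))
      (integrable_mul_of_memLp (hf.condExp (by norm_num)) hd),
      integral_mul_condExpIncrement_succ (hf.condExp (by norm_num)) stronglyMeasurable_condExp hf,
      sub_zero]

/-- Bessel's inequality: the full sum up to N telescopes to ∫ E(f | F_N) f, and its gap to ∫ f² is ∫
(f - E(f | F_N))². -/
theorem sum_integral_condExpIncrement_sq_le (hf : MemLp f 2 μ) (N : ℕ) :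
    ∑ n ∈ Finset.range N, ∫ x, condExpIncrement μ F f n x ^ 2 ∂μ ≤ ∫ x, f x ^ 2 ∂μ := by
  have hnn : ∀ n, 0 ≤ ∫ x, condExpIncrement μ F f n x ^ 2 ∂μ := fun n =>
    integral_nonneg fun x => sq_nonneg _
  refine (Finset.sum_le_sum_of_subset_of_nonneg (Finset.range_subset_range.2 (Nat.le_succ N))
    fun n _ _ => hnn n).trans ?_
  have hE : MemLp (μ[f | F N]) 2 μ := hf.condExp (by norm_num)
  have h1 : ∑ n ∈ Finset.range (N + 1), ∫ x, condExpIncrement μ F f n x ^ 2 ∂μ =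
      ∫ x, (μ[f | F N]) x * f x ∂μ := by
    simp only [integral_condExpIncrement_sq hf]
    rw [← integral_finsetSum _ fun n _ =>
      integrable_mul_of_memLp (memLp_condExpIncrement hf n) hf]
    simp only [← Finset.sum_mul, sum_condExpIncrement]
  have h2 := integral_mul_condExp (F.le N) hE stronglyMeasurable_condExp hf
  have h3 : 0 ≤ ∫ x, (f x - (μ[f | F N]) x) ^ 2 ∂μ := integral_nonneg fun x => sq_nonneg _
  have hff := integrable_mul_of_memLp hf hf
  have hEf := integrable_mul_of_memLp hE hf
  have hEE := integrable_mul_of_memLp hE hE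
  have h4 : ∫ x, (f x - (μ[f | F N]) x) ^ 2 ∂μ =
      ∫ x, f x ^ 2 ∂μ - ∫ x, (μ[f | F N]) x * f x ∂μ := by
    have : ∀ x, (f x - (μ[f | F N]) x) ^ 2 = f x * f x - (μ[f | F N]) x * f x -
        ((μ[f | F N]) x * f x - (μ[f | F N]) x * (μ[f | F N]) x) := fun x => by ring
    simp only [this]
    have h5 := integral_sub (hff.sub hEf) (hEf.sub hEE)
    simp only [Pi.sub_apply] at h5
    rw [h5, integral_sub hff hEf, integral_sub hEf hEE, h2, sub_self, sub_zero]
    simp only [pow_two]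
  rw [h1]
  linarith

/-- Predictability is essential: G_{n+1} is F_n-measurable, so multiplication by it commutes with
both conditional expectations that form the increment. -/
theorem integral_transform_mul (hG : BoundedPredictable F G M) (hf : MemLp f 2 μ) (hg : MemLp g 2 μ) (n : ℕ) :
    ∫ x, (G n x * condExpIncrement μ F f n x) * g x ∂μ =
      ∫ x, (G n x * condExpIncrement μ F g n x) * f x ∂μ := by
  have key : ∀ {f g : X → ℝ} (_ : MemLp f 2 μ) (_ : MemLp g 2 μ) (γ : X → ℝ) (k : ℕ),
      StronglyMeasurable[F k] γ → (∀ x, |γ x| ≤ M) →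
      ∫ x, (γ x * (μ[f | F k]) x) * g x ∂μ =
        ∫ x, (γ x * (μ[f | F k]) x) * (μ[g | F k]) x ∂μ := by
    intro f g hf hg γ k hγ hγM
    refine (integral_mul_condExp (F.le k) ?_ (hγ.mul stronglyMeasurable_condExp) hg).symm
    exact memLp_bdd_mul (hγ.mono (F.le k)).aestronglyMeasurable hγM (hf.condExp (by norm_num))
  have symm : ∀ (γ : X → ℝ) (k : ℕ), StronglyMeasurable[F k] γ → (∀ x, |γ x| ≤ M) →
      ∫ x, (γ x * (μ[f | F k]) x) * g x ∂μ = ∫ x, (γ x * (μ[g | F k]) x) * f x ∂μ := by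
    intro γ k hγ hγM
    rw [key hf hg γ k hγ hγM, key hg hf γ k hγ hγM]
    exact integral_congr_ae (.of_forall fun x => by ring)
  cases n with
  | zero => exact symm _ 0 hG.zero (hG.bound 0)
  | succ n =>
    have hGm := ((hG.succ n).mono (F.le n)).aestronglyMeasurable (μ := μ)
    have hint : ∀ {f g : X → ℝ} (_ : MemLp f 2 μ) (_ : MemLp g 2 μ) (k : ℕ),
        Integrable (fun x => (G (n + 1) x * (μ[f | F k]) x) * g x) μ := fun hf hg k =>
      integrable_mul_of_memLp (memLp_bdd_mul hGm (hG.bound _) (hf.condExp (by norm_num))) hg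
    simp only [condExpIncrement, Pi.sub_apply, mul_sub, sub_mul]
    rw [integral_sub (hint hf hg _) (hint hf hg _), integral_sub (hint hg hf _) (hint hg hf _),
      symm _ n (hG.succ n) (hG.bound _), symm _ (n + 1) ((hG.succ n).mono (F.mono (Nat.le_succ n))) (hG.bound _)]

/-- For k = l + 1, every factor except the k-th increment of f is F_l-measurable, and that increment
is orthogonal to F_l. -/
theorem integral_transform_mul_transform_of_lt (hG : BoundedPredictable F G M) (hf : MemLp f 2 μ) {n k : ℕ} (hnk : n < k) :
    ∫ x, (G n x * condExpIncrement μ F f n x) * (G k x * condExpIncrement μ F f k x) ∂μ = 0 := by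
  obtain ⟨l, rfl⟩ : ∃ l, k = l + 1 := ⟨k - 1, by omega⟩
  have hφ : MemLp (fun x => G (l + 1) x * (G n x * condExpIncrement μ F f n x)) 2 μ :=
    memLp_bdd_mul ((hG.succ l).mono (F.le l)).aestronglyMeasurable (hG.bound _)
      (memLp_transform hG hf n)
  have hle : F n ≤ F l := F.mono (by omega)
  have := integral_mul_condExpIncrement_succ (n := l) hφ ((hG.succ l).mul
    (((hG.adapted n).mul (stronglyMeasurable_condExpIncrement n)).mono hle))
    hf
  rw [← this]
  exact integral_congr_ae (.of_forall fun x => by ring)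

/-- One term of the martingale transform, as a linear map. -/
noncomputable def transformTerm (hG : BoundedPredictable F G M) (n : ℕ) : Lp ℝ 2 μ →ₗ[ℝ] Lp ℝ 2 μ where
  toFun f := (memLp_transform hG (Lp.memLp f) n).toLp
  map_add' f g := by
    rw [← MemLp.toLp_add, MemLp.toLp_eq_toLp_iff]
    filter_upwards [condExpIncrement_congr (F := F) (Lp.coeFn_add f g) n,
      condExpIncrement_add (F := F) ((Lp.memLp f).integrable (by norm_num))
        ((Lp.memLp g).integrable (by norm_num)) n] with x h1 h2
    simp only [Pi.add_apply] at *
    rw [h1, h2]; ring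
  map_smul' c f := by
    rw [RingHom.id_apply, ← MemLp.toLp_const_smul, MemLp.toLp_eq_toLp_iff]
    filter_upwards [condExpIncrement_congr (F := F) (Lp.coeFn_smul c f) n,
      condExpIncrement_smul (μ := μ) (F := F) (f := f) c n] with x h1 h2
    simp only [Pi.smul_apply, smul_eq_mul] at *
    rw [h1, h2]; ring

theorem inner_transformTerm (hG : BoundedPredictable F G M) (n : ℕ) (f g : Lp ℝ 2 μ) :
    inner ℝ (transformTerm hG n f) g = inner ℝ f (transformTerm hG n g) := by
  have h1 := inner_toLp_eq (memLp_transform hG (Lp.memLp f) n) (Lp.memLp g)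
  have h2 := inner_toLp_eq (memLp_transform hG (Lp.memLp g) n) (Lp.memLp f)
  rw [Lp.toLp_coeFn] at h1 h2
  rw [real_inner_comm _ f]
  exact h1.trans ((integral_transform_mul hG (Lp.memLp f) (Lp.memLp g) n).trans h2.symm)

theorem summable_transformTerm (hG : BoundedPredictable F G M) (f : Lp ℝ 2 μ) :
    Summable fun n => transformTerm hG n f := by
  have hf := Lp.memLp f
  have horth : ∀ {n k}, n < k →
      inner ℝ (transformTerm hG n f) (transformTerm hG k f) = 0 := fun {n k} h =>
    (inner_toLp_eq (memLp_transform hG hf n) (memLp_transform hG hf k)).trans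
      (integral_transform_mul_transform_of_lt hG hf h)
  refine summable_of_pairwise_inner_eq_zero (fun n k hnk => ?_) ?_
  · rcases lt_or_gt_of_ne hnk with h | h
    · exact horth h
    · rw [real_inner_comm]; exact horth h
  have hsum : Summable fun n => ∫ x, condExpIncrement μ F f n x ^ 2 ∂μ :=
    summable_of_sum_range_le (fun n => integral_nonneg fun x => sq_nonneg _)
      (sum_integral_condExpIncrement_sq_le hf)
  refine Summable.of_nonneg_of_le (fun n => sq_nonneg _) (fun n => ?_) (hsum.mul_left (M ^ 2))
  have hn : ‖transformTerm hG n f‖ ^ 2 =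
      ∫ x, (G n x * condExpIncrement μ F f n x) * (G n x * condExpIncrement μ F f n x) ∂μ := by
    rw [← real_inner_self_eq_norm_sq]
    exact inner_toLp_eq (memLp_transform hG hf n) (memLp_transform hG hf n)
  have hd := memLp_condExpIncrement (F := F) hf n
  rw [hn, ← integral_const_mul]
  refine integral_mono (integrable_mul_of_memLp (memLp_transform hG hf n)
    (memLp_transform hG hf n)) (hd.integrable_sq.const_mul _) fun x => ?_
  have h1 : G n x ^ 2 ≤ M ^ 2 := sq_le_sq' (by linarith [(abs_le.1 (hG.bound n x)).1])
    (abs_le.1 (hG.bound n x)).2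
  have h2 := mul_le_mul_of_nonneg_right h1 (sq_nonneg (condExpIncrement μ F f n x))
  nlinarith

/-- The martingale transform with respect to a bounded predictable process is a bounded
self-adjoint operator. -/
theorem exists_transform (hG : BoundedPredictable F G M) :
    ∃ W : Lp ℝ 2 μ →L[ℝ] Lp ℝ 2 μ, IsSelfAdjoint W ∧
    ∀ f : Lp ℝ 2 μ, HasSum (fun n => (memLp_transform hG (Lp.memLp f) n).toLp) (W f) := by
  have hs := summable_transformTerm (μ := μ) hG
  let L : Lp ℝ 2 μ →ₗ[ℝ] Lp ℝ 2 μ :=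
    { toFun := fun f => ∑' n, transformTerm hG n f
      map_add' := fun f g => by
        simp only [map_add]
        exact (hs f).tsum_add (hs g)
      map_smul' := fun c f => by
        simp only [map_smul, RingHom.id_apply]
        exact (hs f).tsum_const_smul c }
  have hL : ∀ f, HasSum (fun n => transformTerm hG n f) (L f) := fun f => (hs f).hasSum
  have hsymm : L.IsSymmetric := by
    intro f g
    have h1 := (innerSL ℝ g).hasSum (hL f)
    have h2 := (innerSL ℝ f).hasSum (hL g)
    simp only [innerSL_apply_apply] at h1 h2
    rw [real_inner_comm]
    refine h1.unique ?_
    convert h2 using 2 with n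
    rw [real_inner_comm, inner_transformTerm hG]
  -- Boundedness is the Hellinger-Toeplitz theorem: a symmetric operator defined on the whole space
  -- is continuous.
  exact ⟨⟨L, hsymm.continuous⟩, ContinuousLinearMap.isSelfAdjoint_iff_isSymmetric.2 hsymm, hL⟩

end Transform

/-! ### The boundary operator -/

section Boundary

variable {I : Type*} {T : SimpleGraph I} {r : I} {w : ℕ → ℝ}

/-- Sets of F_n are unions of sets C^n(ξ). No null set is involved, so the chosen version of E(f |
F_k) is constant on each C^k(η). -/
theorem apply_eq_of_measurableSet_levelFiltration (hT : T.IsTree) {n : ℕ} {A : Set (Ends T r)}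
    (hA : MeasurableSet[levelFiltration T r n] A) {ξ η : Ends T r} (h : ξ n = η n) :
    ξ ∈ A ↔ η ∈ A := by
  induction A, hA using MeasurableSpace.generateFrom_induction with
  | hC A hA _ =>
    obtain ⟨k, hk, ζ, rfl⟩ := hA
    rw [mem_levelSet_iff hT, mem_levelSet_iff hT, Ends.apply_eq_of_le hT hk h]
  | empty => simp
  | compl A _ ih => simp [ih]
  | iUnion s _ ih => simp [ih]

theorem apply_eq_of_stronglyMeasurable_levelFiltration (hT : T.IsTree) {n : ℕ} {g : Ends T r → ℝ}
    (hg : StronglyMeasurable[levelFiltration T r n] g) {ξ η : Ends T r} (h : ξ n = η n) :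
    g ξ = g η :=
  (apply_eq_of_measurableSet_levelFiltration hT
    (hg.measurable (measurableSet_singleton (g η))) h).2 rfl

theorem measurableSet_levelSet (k : ℕ) (ξ : Ends T r) : MeasurableSet (levelSet k ξ) :=
  measurableSet_cylinder _

theorem measurableSet_levelFiltration_levelSet (k : ℕ) (ξ : Ends T r) :
    MeasurableSet[levelFiltration T r k] (levelSet k ξ) :=
  MeasurableSpace.measurableSet_generateFrom ⟨k, le_rfl, ξ, rfl⟩

theorem stronglyMeasurable_apply [Countable I] (hT : T.IsTree) (k : ℕ) (g : I → ℝ) :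
    StronglyMeasurable[levelFiltration T r k] fun η : Ends T r => g (η k) := by
  suffices h : Measurable[levelFiltration T r k] fun η : Ends T r => g (η k) from
    h.stronglyMeasurable
  intro s _
  have : (fun η : Ends T r => g (η k)) ⁻¹' s = ⋃ v ∈ g ⁻¹' s, {η : Ends T r | η k = v} := by
    ext η; simp
  rw [this]
  refine MeasurableSet.biUnion (Set.to_countable _) fun v _ => ?_
  rcases Set.eq_empty_or_nonempty {η : Ends T r | η k = v} with h | ⟨ξ, hξ⟩
  · rw [h]; exact @MeasurableSet.empty _ (levelFiltration T r k)
  · convert measurableSet_levelFiltration_levelSet k ξ using 1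
    ext η
    rw [mem_levelSet_iff hT]
    have : ξ k = v := hξ
    rw [this]; rfl

theorem sum_increment (n : ℕ) : ∑ k ∈ Finset.range (n + 1), increment w k = w n := by
  induction n with
  | zero => simp [increment]
  | succ n ih => rw [Finset.sum_range_succ, ih]; simp [increment]

/-- Two geodesics agree on an initial segment of levels, and the increments over the common levels
add up to w at the meet. On the diagonal all levels are common and the sum is the supremum. -/
theorem boundaryKernel_eq_tsum (hT : T.IsTree) (hpos : ∀ n, 0 < w n) (hw : StrictMono w)
    (η ξ : Ends T r) : boundaryKernel w η ξ =
      ∑' k, (levelSet k η).indicator (fun _ => ENNReal.ofReal (increment w k)) ξ := by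
  classical
  have hsum : ∀ n, ∑ k ∈ Finset.range (n + 1), ENNReal.ofReal (increment w k) =
      ENNReal.ofReal (w n) := fun n => by
    rw [← ENNReal.ofReal_sum_of_nonneg fun k _ => (increment_pos hpos hw k).le, sum_increment]
  by_cases h : η = ξ
  · subst h
    have h1 : ∀ k, (levelSet k η).indicator (fun _ => ENNReal.ofReal (increment w k)) η =
        ENNReal.ofReal (increment w k) := fun k =>
      Set.indicator_of_mem ((mem_levelSet_iff hT).2 rfl) _
    simp only [boundaryKernel, if_true, h1]
    refine tendsto_nhds_unique (tendsto_atTop_iSup fun m n hmn =>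
      ENNReal.ofReal_le_ofReal (hw.monotone hmn)) ?_
    have := (ENNReal.tendsto_nat_tsum fun k => ENNReal.ofReal (increment w k)).comp
      (tendsto_add_atTop_nat 1)
    exact this.congr fun n => hsum n
  · have hex : ∃ k, η k ≠ ξ k := by
      by_contra! hc
      exact h (Subtype.ext (funext hc))
    -- Both geodesics start at r, so the first disagreement has positive index and m is the last
    -- common level.
    obtain ⟨m, hm⟩ : ∃ m, Nat.find hex = m + 1 := by
      refine Nat.exists_eq_succ_of_ne_zero fun h0 => Nat.find_spec hex ?_
      rw [h0, η.2.1, ξ.2.1]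
    have hiff : ∀ k, η k = ξ k ↔ k ≤ m := by
      intro k
      constructor
      · intro hk
        by_contra hc
        exact Nat.find_spec hex (Ends.apply_eq_of_le hT (by omega) hk)
      · intro hk
        exact not_not.1 (Nat.find_min hex (m := k) (by omega))
    have hmeet : meetLevel η ξ = m := by
      have : {n | η n = ξ n} = Set.Iic m := by ext k; exact hiff k
      rw [meetLevel, this, csSup_Iic]
    rw [boundaryKernel, if_neg h, hmeet, ← hsum, tsum_eq_sum (s := Finset.range (m + 1))]
    · refine Finset.sum_congr rfl fun k hk => ?_
      rw [Set.indicator_of_mem]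
      rw [mem_levelSet_iff hT]
      exact ((hiff k).2 (by simp at hk; omega)).symm
    · intro k hk
      rw [Set.indicator_of_notMem]
      rw [mem_levelSet_iff hT]
      intro hk'
      exact hk (by have := (hiff k).1 hk'.symm; simp; omega)

theorem measurableSet_apply_eq [Countable I] (hT : T.IsTree) (k : ℕ) :
    MeasurableSet {p : Ends T r × Ends T r | p.2 k = p.1 k} := by
  have : {p : Ends T r × Ends T r | p.2 k = p.1 k} =
      ⋃ v ∈ {v | level T r v = k}, cylinder T r v ×ˢ cylinder T r v := by
    ext ⟨ξ, η⟩
    simp only [Set.mem_ofPred_eq, Set.mem_iUnion, Set.mem_prod, mem_cylinder_iff hT]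
    constructor
    · intro h
      exact ⟨η k, η.level_eq hT k, by rw [η.level_eq hT, h], by rw [η.level_eq hT]⟩
    · rintro ⟨v, rfl, h1, h2⟩
      rw [h1, h2]
  rw [this]
  exact MeasurableSet.biUnion (Set.to_countable _) fun v _ =>
    (measurableSet_cylinder v).prod (measurableSet_cylinder v)

variable {μ : Measure (Ends T r)}

theorem lintegral_boundaryKernel (hT : T.IsTree) (hpos : ∀ n, 0 < w n) (hw : StrictMono w)
    {f : Ends T r → ℝ≥0∞} (hf : Measurable f) (η : Ends T r) :
    ∫⁻ ξ, boundaryKernel w η ξ * f ξ ∂μ =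
      ∑' k, ENNReal.ofReal (increment w k) * ∫⁻ ξ in levelSet k η, f ξ ∂μ := by
  simp only [boundaryKernel_eq_tsum hT hpos hw, ← ENNReal.tsum_mul_right]
  have hm : ∀ k, Measurable fun ξ =>
      (levelSet k η).indicator (fun _ => ENNReal.ofReal (increment w k)) ξ * f ξ := fun k =>
    (measurable_const.indicator (measurableSet_levelSet k η)).mul hf
  rw [lintegral_tsum fun k => (hm k).aemeasurable]
  refine tsum_congr fun k => ?_
  rw [← lintegral_indicator (measurableSet_levelSet k η), ← lintegral_const_mul _
    (hf.indicator (measurableSet_levelSet k η))]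
  refine lintegral_congr fun ξ => ?_
  by_cases h : ξ ∈ levelSet k η <;> simp [h]

/-- The relation ξ ∈ C^k(η) is symmetric, so by Tonelli the double integral is ∫ f times the
potential of μ, at most M ∫ f. -/
theorem ae_lintegral_boundaryKernel_lt_top [Countable I] [IsProbabilityMeasure μ] (hT : T.IsTree)
    (hpos : ∀ n, 0 < w n) (hw : StrictMono w) {M : ℝ}
    (hM : ∀ (η : Ends T r) (K : ℕ),
      ∑ k ∈ Finset.range K, increment w k * μ.real (levelSet k η) ≤ M)
    {f : Ends T r → ℝ≥0∞} (hf : Measurable f) (hfi : ∫⁻ ξ, f ξ ∂μ < ∞) :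
    ∀ᵐ η ∂μ, ∫⁻ ξ, boundaryKernel w η ξ * f ξ ∂μ < ∞ := by
  have hmeas : ∀ k, Measurable fun p : Ends T r × Ends T r =>
      {p : Ends T r × Ends T r | p.2 k = p.1 k}.indicator (fun p => f p.2) p := fun k =>
    (hf.comp measurable_snd).indicator (measurableSet_apply_eq hT k)
  have hset : ∀ k (η : Ends T r), ∫⁻ ξ in levelSet k η, f ξ ∂μ =
      ∫⁻ ξ, {p : Ends T r × Ends T r | p.2 k = p.1 k}.indicator (fun p => f p.2) (η, ξ) ∂μ := by
    intro k η
    rw [← lintegral_indicator (measurableSet_levelSet k η)]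
    refine lintegral_congr fun ξ => ?_
    by_cases h : ξ k = η k
    · rw [Set.indicator_of_mem ((mem_levelSet_iff hT).2 h), Set.indicator_of_mem (by exact h)]
    · rw [Set.indicator_of_notMem (fun h' => h ((mem_levelSet_iff hT).1 h')),
        Set.indicator_of_notMem (by exact h)]
  have hmeas' : ∀ k, Measurable fun η : Ends T r => ∫⁻ ξ in levelSet k η, f ξ ∂μ := fun k => by
    simp only [hset]
    exact (hmeas k).lintegral_prod_right'
  have hbound : ∀ ξ : Ends T r, ∑' k, ENNReal.ofReal (increment w k) * μ (levelSet k ξ) ≤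
      ENNReal.ofReal M := by
    intro ξ
    refine ENNReal.tsum_le_of_sum_range_le fun n => ?_
    have : ∀ k, ENNReal.ofReal (increment w k) * μ (levelSet k ξ) =
        ENNReal.ofReal (increment w k * μ.real (levelSet k ξ)) := fun k => by
      rw [ENNReal.ofReal_mul (increment_pos hpos hw k).le, ofReal_measureReal]
    simp only [this]
    rw [← ENNReal.ofReal_sum_of_nonneg fun k _ =>
      mul_nonneg (increment_pos hpos hw k).le measureReal_nonneg]
    exact ENNReal.ofReal_le_ofReal (hM ξ n)
  have hswap : ∀ k, ∫⁻ η, ∫⁻ ξ in levelSet k η, f ξ ∂μ ∂μ =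
      ∫⁻ ξ, μ (levelSet k ξ) * f ξ ∂μ := by
    intro k
    simp only [hset]
    rw [lintegral_lintegral_swap (hmeas k).aemeasurable]
    refine lintegral_congr fun ξ => ?_
    rw [mul_comm, ← lintegral_indicator_const (measurableSet_levelSet k ξ)]
    refine lintegral_congr fun η => ?_
    by_cases h : ξ k = η k
    · rw [Set.indicator_of_mem ((mem_levelSet_iff hT).2 h.symm), Set.indicator_of_mem (by exact h)]
    · rw [Set.indicator_of_notMem (fun h' => h ((mem_levelSet_iff hT).1 h').symm),
        Set.indicator_of_notMem (by exact h)]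
  have hμm : ∀ k, Measurable fun ξ : Ends T r => μ (levelSet k ξ) := by
    intro k
    have h := ((stronglyMeasurable_apply hT k fun v => μ.real (cylinder T r v)).mono
      ((levelFiltration T r).le k)).measurable.ennreal_ofReal
    have h' : ∀ ξ : Ends T r, ENNReal.ofReal (μ.real (cylinder T r (ξ k))) = μ (levelSet k ξ) :=
      fun ξ => ofReal_measureReal
    simpa only [h'] using h
  simp only [lintegral_boundaryKernel hT hpos hw hf]
  refine ae_lt_top (.tsum fun k => (hmeas' k).const_mul _) ?_
  rw [lintegral_tsum fun k => ((hmeas' k).const_mul _).aemeasurable]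
  simp only [lintegral_const_mul _ (hmeas' _), hswap]
  have hm : ∀ k, Measurable fun ξ => μ (levelSet k ξ) * f ξ := fun k => (hμm k).mul hf
  have hc : ∀ k, ENNReal.ofReal (increment w k) * ∫⁻ ξ, μ (levelSet k ξ) * f ξ ∂μ =
      ∫⁻ ξ, ENNReal.ofReal (increment w k) * (μ (levelSet k ξ) * f ξ) ∂μ := fun k =>
    (lintegral_const_mul _ (hm k)).symm
  simp only [hc]
  rw [← lintegral_tsum fun k => ((hm k).const_mul _).aemeasurable]
  refine ne_top_of_le_ne_top (ENNReal.mul_lt_top ENNReal.ofReal_lt_top hfi).ne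
    (b := ENNReal.ofReal M * ∫⁻ ξ, f ξ ∂μ) ?_
  rw [← lintegral_const_mul _ hf]
  refine lintegral_mono fun ξ => ?_
  simp only [← mul_assoc, ENNReal.tsum_mul_right]
  exact mul_le_mul_left (hbound ξ) _

theorem hasSum_boundaryOperator (hT : T.IsTree) (hpos : ∀ n, 0 < w n) (hw : StrictMono w)
    {f : Ends T r → ℝ} (hf : Measurable f) (hfi : Integrable f μ) {η : Ends T r}
    (h : ∫⁻ ξ, boundaryKernel w η ξ * ‖f ξ‖ₑ ∂μ < ∞) :
    HasSum (fun k => increment w k * ∫ ξ in levelSet k η, f ξ ∂μ) (boundaryOperator w μ f η) := by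
  rw [lintegral_boundaryKernel hT hpos hw hf.enorm] at h
  let A : ℕ → Ends T r → ℝ := fun k ξ => increment w k * (levelSet k η).indicator f ξ
  have hAi : ∀ k, Integrable (A k) μ := fun k =>
    (hfi.indicator (measurableSet_levelSet k η)).const_mul _
  have hAn : ∀ k, ∫ ξ, ‖A k ξ‖ ∂μ =
      (ENNReal.ofReal (increment w k) * ∫⁻ ξ in levelSet k η, ‖f ξ‖ₑ ∂μ).toReal := by
    intro k
    rw [integral_norm_eq_lintegral_enorm (hAi k).1,
      ← lintegral_indicator (measurableSet_levelSet k η),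
      ← lintegral_const_mul _ (hf.enorm.indicator (measurableSet_levelSet k η))]
    congr 1
    refine lintegral_congr fun ξ => ?_
    by_cases hξ : ξ ∈ levelSet k η
    · simp [A, hξ, enorm_mul, Real.enorm_of_nonneg (increment_pos hpos hw k).le]
    · simp [A, hξ]
  have hs : Summable fun k => ∫ ξ, ‖A k ξ‖ ∂μ := by
    simp only [hAn]
    exact ENNReal.summable_toReal h.ne
  have hsum := hasSum_integral_of_summable_integral_norm hAi hs
  have hA : ∀ k, ∫ ξ, A k ξ ∂μ = increment w k * ∫ ξ in levelSet k η, f ξ ∂μ := fun k => by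
    rw [integral_const_mul, integral_indicator (measurableSet_levelSet k η)]
  simp only [hA] at hsum
  have hb : boundaryOperator w μ f η = ∫ ξ, ∑' k, A k ξ ∂μ := by
    refine integral_congr_ae (.of_forall fun ξ => ?_)
    simp only [A]
    -- This holds even where the kernel is infinite: there `toReal` gives 0, and so does the real
    -- `tsum` of a divergent series.
    rw [boundaryKernel_eq_tsum hT hpos hw, ENNReal.tsum_toReal_eq, ← tsum_mul_right]
    · refine tsum_congr fun k => ?_
      by_cases hξ : ξ ∈ levelSet k η
      · simp [hξ, ENNReal.toReal_ofReal (increment_pos hpos hw k).le]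
      · simp [hξ]
    · intro k
      by_cases hξ : ξ ∈ levelSet k η <;> simp [hξ]
  rwa [hb]

theorem setIntegral_levelSet [IsProbabilityMeasure μ] (hT : T.IsTree) {f : Ends T r → ℝ}
    (hf : Integrable f μ) (k : ℕ) (η : Ends T r) :
    ∫ ξ in levelSet k η, f ξ ∂μ = μ.real (levelSet k η) * (μ[f | levelFiltration T r k]) η := by
  rw [← setIntegral_condExp ((levelFiltration T r).le k) hf
    (measurableSet_levelFiltration_levelSet k η), setIntegral_congr_fun
    (measurableSet_levelSet k η) (g := fun _ => (μ[f | levelFiltration T r k]) η),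
    setIntegral_const, smul_eq_mul]
  intro ξ hξ
  exact apply_eq_of_stronglyMeasurable_levelFiltration hT stronglyMeasurable_condExp
    ((mem_levelSet_iff hT).1 hξ)

/-- The process `G_n = M - ∑_{k < n} Δ_k(w) μ(C^k)`. -/
noncomputable def tailSeries (w : ℕ → ℝ) (μ : Measure (Ends T r)) (M : ℝ) (n : ℕ)
    (η : Ends T r) : ℝ :=
  M - ∑ k ∈ Finset.range n, increment w k * μ.real (levelSet k η)

theorem tailSeries_succ (M : ℝ) (n : ℕ) (η : Ends T r) : tailSeries w μ M n η -
    tailSeries w μ M (n + 1) η = increment w n * μ.real (levelSet n η) := by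
  simp only [tailSeries, Finset.sum_range_succ]; ring

/-- Written as M minus a partial sum, G_{n+1} depends only on levels up to n and is bounded at every
point; the tail series agrees with it only almost everywhere. -/
theorem boundedPredictable_tailSeries [Countable I] (hT : T.IsTree) (hpos : ∀ n, 0 < w n)
    (hw : StrictMono w) {M : ℝ}
    (hM : ∀ (η : Ends T r) (K : ℕ),
      ∑ k ∈ Finset.range K, increment w k * μ.real (levelSet k η) ≤ M) :
    BoundedPredictable (levelFiltration T r) (tailSeries w μ M) M where
  zero := by
    have : tailSeries w μ M 0 = fun _ => M := by funext η; simp [tailSeries]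
    rw [this]
    exact stronglyMeasurable_const
  succ n := by
    refine stronglyMeasurable_const.sub (Finset.stronglyMeasurable_fun_sum _ fun k hk => ?_)
    exact (stronglyMeasurable_apply hT k fun v => increment w k * μ.real (cylinder T r v)).mono
      ((levelFiltration T r).mono (by simp at hk; omega))
  bound n η := by
    have h0 : 0 ≤ ∑ k ∈ Finset.range n, increment w k * μ.real (levelSet k η) :=
      Finset.sum_nonneg fun k _ => mul_nonneg (increment_pos hpos hw k).le measureReal_nonneg
    have := hM η n
    exact abs_le.2 ⟨by simp only [tailSeries]; linarith, by simp only [tailSeries]; linarith⟩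

/-- Summation by parts, through `tailSeries_succ`. -/
theorem sum_tailSeries_mul_condExpIncrement {f : Ends T r → ℝ} (M : ℝ) (N : ℕ) (η : Ends T r) :
    ∑ n ∈ Finset.range (N + 1),
        tailSeries w μ M n η * condExpIncrement μ (levelFiltration T r) f n η =
      ∑ k ∈ Finset.range (N + 1),
        increment w k * μ.real (levelSet k η) * (μ[f | levelFiltration T r k]) η +
      tailSeries w μ M (N + 1) η * (μ[f | levelFiltration T r N]) η := by
  induction N with
  | zero =>
    have := tailSeries_succ (w := w) (μ := μ) M 0 η
    simp only [Finset.sum_range_one, zero_add, condExpIncrement, ← this]; ring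
  | succ N ih =>
    have := tailSeries_succ (w := w) (μ := μ) M (N + 1) η
    rw [Finset.sum_range_succ, ih, Finset.sum_range_succ _ (N + 1), ← this]
    simp only [condExpIncrement, Pi.sub_apply]; ring

theorem ae_measure_levelSet_pos [Countable I] [IsProbabilityMeasure μ] :
    ∀ᵐ η ∂μ, ∀ n, 0 < μ.real (levelSet n η) := by
  have : ∀ᵐ η ∂μ, ∀ v, μ (cylinder T r v) = 0 → η ∉ cylinder T r v := by
    rw [ae_all_iff]
    intro v
    by_cases h : μ (cylinder T r v) = 0
    · filter_upwards [measure_eq_zero_iff_ae_notMem.1 h] with η hη _ using hη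
    · exact .of_forall fun η h' => absurd h' h
  filter_upwards [this] with η hη n
  exact ENNReal.toReal_pos (fun h => hη (η n) h ⟨n, rfl⟩) (measure_ne_top _ _)

/-- A subsequence of the partial sums converges a.e. to the L² sum. The boundary term of the
summation by parts tends to 0 by martingale convergence, leaving the series of
`hasSum_boundaryOperator`. -/
theorem ae_eq_boundaryOperator [Countable I] [IsProbabilityMeasure μ] (hT : T.IsTree)
    (hpos : ∀ n, 0 < w n) (hw : StrictMono w) {M : ℝ}
    (hM : ∀ (η : Ends T r) (K : ℕ),
      ∑ k ∈ Finset.range K, increment w k * μ.real (levelSet k η) ≤ M)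
    (hsum : ∀ᵐ η ∂μ, HasSum (fun k => increment w k * μ.real (levelSet k η)) M)
    (f g : Lp ℝ 2 μ)
    (hg : HasSum (fun n => (memLp_transform (boundedPredictable_tailSeries hT hpos hw hM)
      (Lp.memLp f) n).toLp) g) :
    g =ᵐ[μ] boundaryOperator w μ f := by
  have hf : Measurable f := (Lp.stronglyMeasurable f).measurable
  have hfi : Integrable f μ := (Lp.memLp f).integrable (by norm_num)
  have hfin := ae_lintegral_boundaryKernel_lt_top hT hpos hw hM hf.enorm hfi.2
  obtain ⟨ns, hns, hlim⟩ := (tendstoInMeasure_of_tendsto_Lp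
    (hg.tendsto_sum_nat.comp (tendsto_add_atTop_nat 1))).exists_seq_tendsto_ae
  have hcoe : ∀ᵐ η ∂μ, ∀ N, (∑ n ∈ Finset.range (N + 1), (memLp_transform
      (boundedPredictable_tailSeries hT hpos hw hM) (Lp.memLp f) n).toLp : Lp ℝ 2 μ) η =
      ∑ n ∈ Finset.range (N + 1),
        tailSeries w μ M n η * condExpIncrement μ (levelFiltration T r) f n η := by
    rw [ae_all_iff]
    intro N
    have h1 : ∀ᵐ η ∂μ, ∀ n, ((memLp_transform (boundedPredictable_tailSeries hT hpos hw hM)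
        (Lp.memLp f) n).toLp : Lp ℝ 2 μ) η =
        tailSeries w μ M n η * condExpIncrement μ (levelFiltration T r) f n η :=
      ae_all_iff.2 fun n => MemLp.coeFn_toLp _
    filter_upwards [h1, Lp.coeFn_finsetSum (Finset.range (N + 1)) fun n =>
      (memLp_transform (boundedPredictable_tailSeries hT hpos hw hM) (Lp.memLp f) n).toLp]
      with η h1 h2
    rw [h2, Finset.sum_apply]
    exact Finset.sum_congr rfl fun n _ => h1 n
  filter_upwards [hfin, hlim, hcoe, hsum, tendsto_ae_condExp (ℱ := levelFiltration T r) (μ := μ) f]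
    with η h1 h2 h3 h4 h5
  refine tendsto_nhds_unique h2 ?_
  have hb := (hasSum_boundaryOperator hT hpos hw hf hfi h1).tendsto_sum_nat.comp
    (tendsto_add_atTop_nat 1)
  have hG : Tendsto (fun N => tailSeries w μ M (N + 1) η) atTop (𝓝 0) := by
    have := (h4.tendsto_sum_nat.comp (tendsto_add_atTop_nat 1)).const_sub M
    rwa [sub_self] at this
  have hlim' := (hb.add (hG.mul h5)).comp hns.tendsto_atTop
  rw [zero_mul, add_zero] at hlim'
  refine hlim'.congr fun i => ?_
  simp only [Function.comp_apply]
  rw [h3, sum_tailSeries_mul_condExpIncrement]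
  congr 1
  refine Finset.sum_congr rfl fun k _ => ?_
  rw [setIntegral_levelSet hT hfi, mul_assoc]

end Boundary
end TreeBoundary

open TreeBoundary
theorem mainTheorem9 {I : Type*} (T : SimpleGraph I) (hT : T.IsTree)
    (hfin : ∀ i, (T.neighborSet i).Finite) (r : I)
    (hbranch : ∀ i, {j | Prec T r i j}.Infinite)
    (w : ℕ → ℝ) (hpos : ∀ n, 0 < w n) (hw : StrictMono w)
    {Ω : Type*} [MeasurableSpace Ω] (P : Measure Ω) [IsProbabilityMeasure P]
    (Y : ℕ → Ω → Option I) (E : ℕ → Ω → ℝ≥0∞)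
    (hX : IsMinimalChain (generator T r w) (some r) P Y E)
    (htransient : P {ω | hittingTime Y E none ω < ∞} < 1)
    (μ : Measure (Ends T r)) (hμ : μ = exitMeasure T r P Y E) :
    IsProbabilityMeasure μ ∧
    ∃ W : Lp ℝ 2 μ →L[ℝ] Lp ℝ 2 μ,
      (∀ f : Lp ℝ 2 μ,
        (∀ᵐ η ∂μ, ∫⁻ ξ, boundaryKernel w η ξ * ‖f ξ‖ₑ ∂μ < ∞) ∧
        W f =ᵐ[μ] boundaryOperator w μ f) ∧
      IsSelfAdjoint W ∧
      ∃ G : ℕ → Ends T r → ℝ,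
        IsStochasticIntegral μ (levelFiltration T r) G W ∧
        (∀ᵐ η ∂μ, (∀ n, 0 < G n η) ∧ Antitone (fun n => G n η) ∧
          Tendsto (fun n => G n η) atTop (𝓝 0) ∧
          ∀ n, HasSum (fun k => increment w (n + k) * μ.real (levelSet (n + k) η)) (G n η)) := by
  have : Countable I := countable_of_finite_neighborSet hT hfin r
  obtain ⟨hprob, M, hM, hsum⟩ := exitMeasure_equilibrium hT hfin hbranch hpos hw hX htransient
  rw [← hμ] at hprob hM hsum
  have hG := boundedPredictable_tailSeries hT hpos hw hM
  obtain ⟨W, hW, hWsum⟩ := exists_transform (μ := μ) hG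
  refine ⟨hprob, W, fun f => ⟨?_, ?_⟩, hW, tailSeries w μ M, ⟨?_, fun f => ⟨_, hWsum f⟩⟩, ?_⟩
  · exact ae_lintegral_boundaryKernel_lt_top hT hpos hw hM
      (Lp.stronglyMeasurable f).measurable.enorm ((Lp.memLp f).integrable (by norm_num)).2
  · exact ae_eq_boundaryOperator hT hpos hw hM hsum f (W f) (hWsum f)
  · exact .of_measurable_add_one hG.zero hG.succ
  · filter_upwards [hsum, ae_measure_levelSet_pos] with η hη hη'
    have hterm : ∀ k, 0 < increment w k * μ.real (levelSet k η) := fun k =>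
      mul_pos (increment_pos hpos hw k) (hη' k)
    -- Where the full series sums to M, removing its first n terms leaves G_n.
    have htail : ∀ n, HasSum (fun k => increment w (n + k) * μ.real (levelSet (n + k) η))
        (tailSeries w μ M n η) := fun n => by
      have := (hasSum_nat_add_iff' n).2 hη
      simp only [add_comm n]
      exact this
    refine ⟨fun n => ?_, antitone_nat_of_succ_le fun n => ?_, ?_, htail⟩
    · exact (hterm (n + 0)).trans_le (le_hasSum (htail n) 0 fun k _ => (hterm (n + k)).le)
    · have := tailSeries_succ (w := w) (μ := μ) M n η
      have := hterm n
      linarith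
    · have := hη.tendsto_sum_nat.const_sub M
      rwa [sub_self] at this
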